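/- Let $k=\mathbb R$ or $k=\mathbb C$, let $q\in k$ be nonzero and not a root of unity, and let $c\in k$, $c\neq 0$. Let $U_q(sl(2))$ be the algebra generated by $X,Y,K^{\pm1}$ (with $K=q^H$) subject to $KX=q^2XK$, $KY=q^{-2}YK$, $XY-YX=\frac{K-K^{-1}}{q-q^{-1}}$, with coproduct $\Delta(X)=X\otimes 1+K^{-1}\otimes X$, $\Delta(Y)=Y\otimes K+1\otimes Y$, $\Delta(K)=K\otimes K$ and counit $\varepsilon(X)=\varepsilon(Y)=0$, $\varepsilon(K)=1$. Let $V$ be the $U_q(sl(2))$-module with basis $(u,v,w)$ and $$X.u=0,\ X.v=-(q+q^{-1})u,\ X.w=v,\quad Y.u=-v,\ Y.v=(q+q^{-1})w,\ Y.w=0,\quad H.u=2u,\ H.v=0,\ H.w=-2w.$$ Put $$v_0=(q^3+q)\,u\otimes w+v\otimes v+(q+q^{-1})\,w\otimes u\in V^{\otimes 2},$$ $$V_1=\mathrm{span}\bigl(q^2u\otimes v-v\otimes u,\ (q^3+q)(u\otimes w-w\otimes u)+(1-q^2)v\otimes v,\ w\otimes v-q^2v\otimes w\bigr)\subset V^{\otimes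 2},$$ and let $A=k(S^2_q)=T(V)/\{V_1,\,v_0-c\}$ be the quantum sphere, the quotient of the tensor algebra by the two-sided ideal generated by $V_1$ and $v_0-c$, with product $\mu:A\otimes A\to A$ and with the action of $U_q(sl(2))$ that extends the one on $V$ through the coproduct: $h.(ab)=\sum(h_{(1)}.a)(h_{(2)}.b)$, $h.1=\varepsilon(h)1$. Let $$\mathcal R=\Bigl(\sum_{n\ge 0}q^{n(n-1)/2}\,\frac{(q-q^{-1})^n}{[n]!}\,X^n\otimes Y^n\Bigr)q^{H\otimes H/2},\qquad [n]!=\prod_{i=1}^n\frac{q^i-q^{-i}}{q-q^{-1}},$$ be the universal $R$-matrix. It acts on $A\otimes A$: $X$ is locally nilpotent on $A$, and $q^{H\otimes H/2}$ is the scalar $q^{\lambda\lambda'/2}$ on the tensor product of the subspaces of $A$ of weights $\lambda,\lambda'\in 2\mathbb Z$, that is, of eigenvalues $\lambda,\lambda'$ of $H$, where $H$ acts on $A$ as the derivation extending its action on $V$. Let $\sigma$ be the flip of $A\otimes A$ and $S=\sigma\mathcal R:A\otimes A\to A\otimes A$. For an operator on two factors, the superscripts $12$, $23$ denote it applied to the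 first and second, respectively second and third, factors of $A\otimes A\otimes A$. Then $S$ is invertible, and, as maps $A\otimes A\otimes A\to A\otimes A$, $$S\mu^{12}=\mu^{23}S^{12}S^{23},\qquad S\mu^{23}=\mu^{12}S^{23}S^{12},$$ $$S^{-1}\mu^{12}=\mu^{23}(S^{-1})^{12}(S^{-1})^{23},\qquad S^{-1}\mu^{23}=\mu^{12}(S^{-1})^{23}(S^{-1})^{12}.$$ -/

import Mathlib

open scoped TensorProduct

noncomputable section

namespace QSphere

variable {k : Type*} [Field k]

/-- The generators of `U_q(sl(2))`; `K` stands for `q ^ H`. -/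
inductive UGen
  | X | Y | K | Kinv

open FreeAlgebra in
/-- The defining relations of `U_q(sl(2))`. -/
inductive URel (q : kˣ) : FreeAlgebra k UGen → FreeAlgebra k UGen → Prop
  | K_Kinv : URel q (ι k UGen.K * ι k UGen.Kinv) 1
  | Kinv_K : URel q (ι k UGen.Kinv * ι k UGen.K) 1
  | K_X : URel q (ι k UGen.K * ι k UGen.X) ((q : k) ^ 2 • (ι k UGen.X * ι k UGen.K))
  | K_Y : URel q (ι k UGen.K * ι k UGen.Y) (((q : k) ^ 2)⁻¹ • (ι k UGen.Y * ι k UGen.K))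
  | X_Y : URel q
      (((q : k) - (q : k)⁻¹) • (ι k UGen.X * ι k UGen.Y - ι k UGen.Y * ι k UGen.X))
      (ι k UGen.K - ι k UGen.Kinv)

/-- The quantum group `U_q(sl(2))`, as an algebra. -/
def Uq (q : kˣ) : Type _ := RingQuot (URel q)

instance (q : kˣ) : Ring (Uq q) := inferInstanceAs (Ring (RingQuot (URel q)))

instance (q : kˣ) : Algebra k (Uq q) := inferInstanceAs (Algebra k (RingQuot (URel q)))

namespace Uq

variable (q : kˣ)

/-- The image of a generator in `U_q(sl(2))`. -/
def gen (g : UGen) : Uq q := RingQuot.mkAlgHom k (URel q) (FreeAlgebra.ι k g)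

/-- An algebra map out of `U_q(sl(2))`, from images of the generators obeying the relations. -/
def lift {B : Type*} [Ring B] [Algebra k B] (f : UGen → B)
    (h₁ : f .K * f .Kinv = 1) (h₂ : f .Kinv * f .K = 1)
    (h₃ : f .K * f .X = (q : k) ^ 2 • (f .X * f .K))
    (h₄ : f .K * f .Y = ((q : k) ^ 2)⁻¹ • (f .Y * f .K))
    (h₅ : ((q : k) - (q : k)⁻¹) • (f .X * f .Y - f .Y * f .X) = f .K - f .Kinv) :
    Uq q →ₐ[k] B :=
  RingQuot.liftAlgHom k ⟨FreeAlgebra.lift k f, by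
    intro x y h
    cases h <;> simpa⟩

variable {q}

@[simp] theorem lift_gen {B : Type*} [Ring B] [Algebra k B] (f : UGen → B) (h₁ h₂ h₃ h₄ h₅)
    (g : UGen) : lift q f h₁ h₂ h₃ h₄ h₅ (gen q g) = f g := by
  unfold lift gen
  erw [RingQuot.liftAlgHom_mkAlgHom_apply]
  simp

theorem algHom_ext {B : Type*} [Semiring B] [Algebra k B] {f g : Uq q →ₐ[k] B}
    (h : ∀ x, f (gen q x) = g (gen q x)) : f = g := by
  refine RingQuot.ringQuot_ext' k f g ?_
  ext x
  exact h x

theorem K_Kinv : gen q .K * gen q .Kinv = 1 := by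
  have := RingQuot.mkAlgHom_rel k (URel.K_Kinv (q := q))
  rw [map_mul, map_one] at this
  exact this

theorem Kinv_K : gen q .Kinv * gen q .K = 1 := by
  have := RingQuot.mkAlgHom_rel k (URel.Kinv_K (q := q))
  rw [map_mul, map_one] at this
  exact this

theorem K_X : gen q .K * gen q .X = (q : k) ^ 2 • (gen q .X * gen q .K) := by
  have := RingQuot.mkAlgHom_rel k (URel.K_X (q := q))
  rw [map_smul, map_mul, map_mul] at this
  exact this

theorem K_Y : gen q .K * gen q .Y = ((q : k) ^ 2)⁻¹ • (gen q .Y * gen q .K) := by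
  have := RingQuot.mkAlgHom_rel k (URel.K_Y (q := q))
  rw [map_smul, map_mul, map_mul] at this
  exact this

theorem X_Y : ((q : k) - (q : k)⁻¹) • (gen q .X * gen q .Y - gen q .Y * gen q .X) =
    gen q .K - gen q .Kinv := by
  have := RingQuot.mkAlgHom_rel k (URel.X_Y (q := q))
  rw [map_smul, map_sub, map_sub, map_mul, map_mul] at this
  exact this

theorem X_Kinv : gen q .X * gen q .Kinv = (q : k) ^ 2 • (gen q .Kinv * gen q .X) := by
  have h : gen q .Kinv * (gen q .K * gen q .X) * gen q .Kinv = gen q .X * gen q .Kinv := by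
    rw [← mul_assoc, Kinv_K, one_mul]
  rw [← h, K_X, mul_smul_comm, smul_mul_assoc, mul_assoc, mul_assoc, K_Kinv, mul_one]

theorem Y_Kinv : gen q .Y * gen q .Kinv = ((q : k) ^ 2)⁻¹ • (gen q .Kinv * gen q .Y) := by
  have h : gen q .Kinv * (gen q .K * gen q .Y) * gen q .Kinv = gen q .Y * gen q .Kinv := by
    rw [← mul_assoc, Kinv_K, one_mul]
  rw [← h, K_Y, mul_smul_comm, smul_mul_assoc, mul_assoc, mul_assoc, K_Kinv, mul_one]

/-- The coproduct on generators. -/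
def comulGen (q : kˣ) : UGen → Uq q ⊗[k] Uq q
  | .X => gen q .X ⊗ₜ 1 + gen q .Kinv ⊗ₜ gen q .X
  | .Y => gen q .Y ⊗ₜ gen q .K + 1 ⊗ₜ gen q .Y
  | .K => gen q .K ⊗ₜ gen q .K
  | .Kinv => gen q .Kinv ⊗ₜ gen q .Kinv

/-- The coproduct `Δ(X) = X ⊗ 1 + K⁻¹ ⊗ X`, `Δ(Y) = Y ⊗ K + 1 ⊗ Y`, `Δ(K) = K ⊗ K`. -/
def comulHom (q : kˣ) : Uq q →ₐ[k] Uq q ⊗[k] Uq q :=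
  lift q (comulGen q)
    (by simp [comulGen, K_Kinv, Algebra.TensorProduct.one_def])
    (by simp [comulGen, Kinv_K, Algebra.TensorProduct.one_def])
    (by
      simp only [comulGen, mul_add, add_mul, Algebra.TensorProduct.tmul_mul_tmul, K_X, K_Kinv,
        Kinv_K, mul_one, one_mul, smul_add, TensorProduct.smul_tmul', TensorProduct.tmul_smul])
    (by
      simp only [comulGen, mul_add, add_mul, Algebra.TensorProduct.tmul_mul_tmul, K_Y,
        mul_one, one_mul, smul_add, TensorProduct.smul_tmul', TensorProduct.tmul_smul])
    (by
      have hq : (q : k) ^ 2 ≠ 0 := pow_ne_zero 2 q.ne_zero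
      have e1 : (gen q .Y * gen q .Kinv) ⊗ₜ[k] (gen q .K * gen q .X)
          = (gen q .Kinv * gen q .Y) ⊗ₜ[k] (gen q .X * gen q .K) := by
        rw [Y_Kinv, K_X, TensorProduct.tmul_smul, TensorProduct.smul_tmul', smul_smul,
          mul_inv_cancel₀ hq, one_smul]
      have e2 : comulGen q .X * comulGen q .Y - comulGen q .Y * comulGen q .X =
          (gen q .X * gen q .Y - gen q .Y * gen q .X) ⊗ₜ[k] gen q .K +
            gen q .Kinv ⊗ₜ[k] (gen q .X * gen q .Y - gen q .Y * gen q .X) := by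
        simp only [comulGen, mul_add, add_mul, Algebra.TensorProduct.tmul_mul_tmul, mul_one,
          one_mul, e1, TensorProduct.sub_tmul, TensorProduct.tmul_sub]
        abel
      rw [e2, smul_add, TensorProduct.smul_tmul', ← TensorProduct.tmul_smul, X_Y,
        TensorProduct.sub_tmul, TensorProduct.tmul_sub]
      simp only [comulGen]
      abel)

/-- The counit. -/
def counitHom (q : kˣ) : Uq q →ₐ[k] k :=
  lift q (fun | .X => 0 | .Y => 0 | .K => 1 | .Kinv => 1)
    (by simp) (by simp) (by simp) (by simp) (by simp)

instance (q : kˣ) : Bialgebra k (Uq q) :=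
  Bialgebra.ofAlgHom (comulHom q) (counitHom q)
    (by
      refine algHom_ext fun x => ?_
      cases x <;> simp [comulHom, comulGen, TensorProduct.tmul_add, TensorProduct.add_tmul, Algebra.TensorProduct.one_def, add_assoc])
    (by
      refine algHom_ext fun x => ?_
      cases x <;> simp [comulHom, comulGen, counitHom])
    (by
      refine algHom_ext fun x => ?_
      cases x <;> simp [comulHom, comulGen, counitHom])


theorem comul_gen (x : UGen) : Coalgebra.comul (R := k) (gen q x) = comulGen q x :=
  lift_gen _ _ _ _ _ _ x

end Uq

/-- The three-dimensional space with basis `(u, v, w)`. -/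
abbrev V (k : Type*) := Fin 3 → k

/-- The first basis vector of `V`, of weight `2`. -/
def u : V k := ![1, 0, 0]

/-- The second basis vector of `V`, of weight `0`. -/
def v : V k := ![0, 1, 0]

/-- The third basis vector of `V`, of weight `-2`. -/
def w : V k := ![0, 0, 1]

/-- The matrices of the generators in the basis `(u, v, w)`:
`X.u = 0`, `X.v = -(q + q⁻¹) u`, `X.w = v`, `Y.u = -v`, `Y.v = (q + q⁻¹) w`, `Y.w = 0`, and
`H.u = 2 u`, `H.v = 0`, `H.w = -2 w` with `K = q ^ H`. -/
def matV (q : kˣ) : UGen → Matrix (Fin 3) (Fin 3) k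
  | .X => !![0, -((q : k) + (q : k)⁻¹), 0; 0, 0, 1; 0, 0, 0]
  | .Y => !![0, 0, 0; -1, 0, 0; 0, (q : k) + (q : k)⁻¹, 0]
  | .K => !![(q : k) ^ 2, 0, 0; 0, 1, 0; 0, 0, ((q : k) ^ 2)⁻¹]
  | .Kinv => !![((q : k) ^ 2)⁻¹, 0, 0; 0, 1, 0; 0, 0, (q : k) ^ 2]

/-- The `U_q(sl(2))`-module structure of `V`. -/
def rhoV (q : kˣ) : Uq q →ₐ[k] Module.End k (V k) :=
  (Matrix.toLinAlgEquiv' (R := k) (n := Fin 3)).toAlgHom.comp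
    (Uq.lift q (matV q)
      (by ext i j; fin_cases i <;> fin_cases j <;> simp [matV, Matrix.mul_apply, Fin.sum_univ_three])
      (by ext i j; fin_cases i <;> fin_cases j <;> simp [matV, Matrix.mul_apply, Fin.sum_univ_three])
      (by ext i j; fin_cases i <;> fin_cases j <;> simp [matV, Matrix.mul_apply, Fin.sum_univ_three])
      (by ext i j; fin_cases i <;> fin_cases j <;> simp [matV, Matrix.mul_apply, Fin.sum_univ_three])
      (by ext i j; fin_cases i <;> fin_cases j <;>
            simp [matV, Matrix.mul_apply, Fin.sum_univ_three] <;> field_simp <;> ring))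

/-- The `U_q(sl(2))`-module structure of `V ⊗ V`, through the coproduct. -/
def rhoVV (q : kˣ) : Uq q →ₐ[k] Module.End k (V k ⊗[k] V k) :=
  (Module.endTensorEndAlgHom (R := k) (S := k) (A := k) (M := V k) (N := V k)).comp
    ((Algebra.TensorProduct.map (rhoV q) (rhoV q)).comp (Uq.comulHom q))

/-- The generator `v₀` of the trivial component `V₀` of `V ⊗ V`. -/
def v0 (q : kˣ) : V k ⊗[k] V k :=
  ((q : k) ^ 3 + q) • (u ⊗ₜ w) + v ⊗ₜ v + ((q : k) + (q : k)⁻¹) • (w ⊗ₜ u)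

/-- The spin one component `V₁` of `V ⊗ V`. -/
def V1 (q : kˣ) : Submodule k (V k ⊗[k] V k) :=
  Submodule.span k
    {(q : k) ^ 2 • (u ⊗ₜ v) - v ⊗ₜ u,
     ((q : k) ^ 3 + q) • (u ⊗ₜ w - w ⊗ₜ u) + (1 - (q : k) ^ 2) • (v ⊗ₜ v),
     w ⊗ₜ v - (q : k) ^ 2 • (v ⊗ₜ w)}

/-- The inclusion of `V ⊗ V` into the tensor algebra, in degree two. -/
def incl2 (k : Type*) [Field k] : V k ⊗[k] V k →ₗ[k] TensorAlgebra k (V k) :=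
  LinearMap.mul' k _ ∘ₗ TensorProduct.map (TensorAlgebra.ι k) (TensorAlgebra.ι k)

/-- The defining relations `V₁ = 0`, `v₀ = c` of the quantum sphere. -/
inductive SphereRel (q : kˣ) (c : k) : TensorAlgebra k (V k) → TensorAlgebra k (V k) → Prop
  | spin1 (x : V k ⊗[k] V k) (hx : x ∈ V1 q) : SphereRel q c (incl2 k x) 0
  | spin0 : SphereRel q c (incl2 k (v0 q)) (algebraMap k _ c)

/-- The quantum sphere `k(S²_q) = T(V) / {V₁, v₀ - c}`. -/
def Sphere (q : kˣ) (c : k) : Type _ := RingQuot (SphereRel q c)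

instance (q : kˣ) (c : k) : Ring (Sphere q c) :=
  inferInstanceAs (Ring (RingQuot (SphereRel q c)))

instance (q : kˣ) (c : k) : Algebra k (Sphere q c) :=
  inferInstanceAs (Algebra k (RingQuot (SphereRel q c)))

namespace Sphere

/-- The quotient map from the tensor algebra of `V` to the quantum sphere. -/
def mk (q : kˣ) (c : k) : TensorAlgebra k (V k) →ₐ[k] Sphere q c :=
  RingQuot.mkAlgHom k (SphereRel q c)

/-- The canonical map from `V` to the quantum sphere. -/
def ι (q : kˣ) (c : k) : V k →ₗ[k] Sphere q c :=
  (mk q c).toLinearMap ∘ₗ TensorAlgebra.ι k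

/-- The linear map `x ⊗ y ↦ f x * f y` on `V ⊗ V`. -/
def mul2 {B : Type*} [Ring B] [Algebra k B] (f : V k →ₗ[k] B) : V k ⊗[k] V k →ₗ[k] B :=
  LinearMap.mul' k B ∘ₗ TensorProduct.map f f

/-- An algebra map out of the quantum sphere. -/
def lift (q : kˣ) (c : k) {B : Type*} [Ring B] [Algebra k B] (f : V k →ₗ[k] B)
    (h₁ : ∀ x ∈ V1 q, mul2 f x = 0) (h₀ : mul2 f (v0 q) = algebraMap k B c) :
    Sphere q c →ₐ[k] B :=
  RingQuot.liftAlgHom k ⟨TensorAlgebra.lift k f, by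
    have h (x) : TensorAlgebra.lift k f (incl2 k x) = mul2 f x := by
      induction x with
      | zero => simp
      | tmul x y => simp [incl2, mul2]
      | add x y hx hy => simp [hx, hy]
    intro x y hxy
    cases hxy with
    | spin1 x hx => rw [h, map_zero, h₁ x hx]
    | spin0 => rw [h, h₀, AlgHom.commutes]⟩

variable {q : kˣ} {c : k}

@[simp] theorem lift_ι {B : Type*} [Ring B] [Algebra k B] (f : V k →ₗ[k] B) (h₁ h₀) (x : V k) :
    lift q c f h₁ h₀ (ι q c x) = f x := by
  unfold lift ι mk
  erw [RingQuot.liftAlgHom_mkAlgHom_apply]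
  simp

theorem mul2_ι (x) : mul2 (ι q c) x = mk q c (incl2 k x) := by
  induction x with
  | zero => simp only [map_zero]
  | tmul x y => simp [incl2, mul2, ι]
  | add x y hx hy => simp only [map_add, hx, hy]

theorem mul2_V1 {x} (hx : x ∈ V1 q) : mul2 (ι q c) x = 0 := by
  rw [mul2_ι, ← map_zero (mk q c)]
  exact RingQuot.mkAlgHom_rel k (SphereRel.spin1 x hx)

theorem mul2_v0 : mul2 (ι q c) (v0 q) = algebraMap k _ c := by
  rw [mul2_ι, ← (mk q c).commutes c]
  exact RingQuot.mkAlgHom_rel k SphereRel.spin0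

theorem induction {P : Sphere q c → Prop}
    (h_scalar : ∀ r, P (algebraMap k _ r)) (h_gen : ∀ x, P (ι q c x))
    (h_mul : ∀ a b, P a → P b → P (a * b)) (h_add : ∀ a b, P a → P b → P (a + b)) (a) : P a := by
  obtain ⟨a, rfl⟩ : ∃ b, mk q c b = a := RingQuot.mkAlgHom_surjective k (SphereRel q c) a
  induction a using TensorAlgebra.induction with
  | algebraMap r => rw [AlgHom.commutes]; exact h_scalar r
  | ι x => exact h_gen x
  | mul a b ha hb => rw [map_mul]; exact h_mul _ _ ha hb
  | add a b ha hb => rw [map_add]; exact h_add _ _ ha hb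

end Sphere

theorem Uq.induction {q : kˣ} {P : Uq q → Prop}
    (h_scalar : ∀ r, P (algebraMap k _ r)) (h_gen : ∀ x, P (gen q x))
    (h_mul : ∀ a b, P a → P b → P (a * b)) (h_add : ∀ a b, P a → P b → P (a + b)) (a) : P a := by
  let mk : FreeAlgebra k UGen →ₐ[k] Uq q := RingQuot.mkAlgHom k (URel q)
  obtain ⟨a, rfl⟩ : ∃ b, mk b = a := RingQuot.mkAlgHom_surjective k (URel q) a
  induction a with
  | grade0 r => rw [AlgHom.commutes]; exact h_scalar r
  | grade1 x => exact h_gen x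
  | mul a b ha hb => rw [map_mul]; exact h_mul _ _ ha hb
  | add a b ha hb => rw [map_add]; exact h_add _ _ ha hb

theorem rhoV_gen (q : kˣ) (g : UGen) (x : V k) :
    rhoV q (Uq.gen q g) x = (matV q g).mulVec x := by
  simp [rhoV]

theorem rhoVV_X (q : kˣ) (x y : V k) : rhoVV q (Uq.gen q .X) (x ⊗ₜ y) =
    (matV q .X).mulVec x ⊗ₜ y + (matV q .Kinv).mulVec x ⊗ₜ (matV q .X).mulVec y := by
  simp [rhoVV, Uq.comulHom, Uq.comulGen, rhoV_gen, Module.endTensorEndAlgHom_apply]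

theorem rhoVV_Y (q : kˣ) (x y : V k) : rhoVV q (Uq.gen q .Y) (x ⊗ₜ y) =
    (matV q .Y).mulVec x ⊗ₜ (matV q .K).mulVec y + x ⊗ₜ (matV q .Y).mulVec y := by
  simp [rhoVV, Uq.comulHom, Uq.comulGen, rhoV_gen, Module.endTensorEndAlgHom_apply]

theorem rhoVV_K (q : kˣ) (x y : V k) : rhoVV q (Uq.gen q .K) (x ⊗ₜ y) =
    (matV q .K).mulVec x ⊗ₜ (matV q .K).mulVec y := by
  simp [rhoVV, Uq.comulHom, Uq.comulGen, rhoV_gen, Module.endTensorEndAlgHom_apply]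

theorem rhoVV_Kinv (q : kˣ) (x y : V k) : rhoVV q (Uq.gen q .Kinv) (x ⊗ₜ y) =
    (matV q .Kinv).mulVec x ⊗ₜ (matV q .Kinv).mulVec y := by
  simp [rhoVV, Uq.comulHom, Uq.comulGen, rhoV_gen, Module.endTensorEndAlgHom_apply]

theorem matV_u (q : kˣ) (g : UGen) : (matV q g).mulVec u = match g with
    | .X => 0 | .Y => -v | .K => (q : k) ^ 2 • u | .Kinv => ((q : k) ^ 2)⁻¹ • u := by
  cases g <;> ext i <;> fin_cases i <;> simp [matV, u, v]

theorem matV_v (q : kˣ) (g : UGen) : (matV q g).mulVec v = match g with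
    | .X => -((q : k) + (q : k)⁻¹) • u | .Y => ((q : k) + (q : k)⁻¹) • w
    | .K => v | .Kinv => v := by
  cases g <;> ext i <;> fin_cases i <;> simp [matV, u, v, w]

theorem matV_w (q : kˣ) (g : UGen) : (matV q g).mulVec w = match g with
    | .X => v | .Y => 0 | .K => ((q : k) ^ 2)⁻¹ • w | .Kinv => (q : k) ^ 2 • w := by
  cases g <;> ext i <;> fin_cases i <;> simp [matV, v, w]

theorem rhoVV_v0 (q : kˣ) (h : Uq q) :
    rhoVV q h (v0 q) = Coalgebra.counit (R := k) h • v0 q := by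
  have hq : (q : k) ≠ 0 := q.ne_zero
  induction h using Uq.induction with
  | h_scalar r => simp [Algebra.algebraMap_eq_smul_one]
  | h_gen x =>
    have hc : Coalgebra.counit (R := k) (Uq.gen q x) = Uq.counitHom q (Uq.gen q x) := rfl
    rw [hc]
    cases x <;>
    simp only [v0, map_add, map_smul, rhoVV_X, rhoVV_Y, rhoVV_K, rhoVV_Kinv, matV_u, matV_v,
      matV_w, Uq.counitHom, Uq.lift_gen, TensorProduct.zero_tmul, TensorProduct.tmul_zero,
      TensorProduct.neg_tmul, TensorProduct.tmul_neg, ← TensorProduct.smul_tmul',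
      TensorProduct.tmul_smul, zero_smul, one_smul, neg_smul] <;>
    match_scalars <;> field_simp <;> ring
  | h_mul a b ha hb =>
    rw [map_mul, Module.End.mul_apply, hb, map_smul, ha, smul_smul, Bialgebra.counit_mul, mul_comm]
  | h_add a b ha hb => simp [ha, hb, add_smul]

theorem rhoVV_V1 (q : kˣ) (h : Uq q) (x) (hx : x ∈ V1 q) : rhoVV q h x ∈ V1 q := by
  have hq : (q : k) ≠ 0 := q.ne_zero
  induction h using Uq.induction generalizing x with
  | h_scalar r => simpa [Algebra.algebraMap_eq_smul_one] using Submodule.smul_mem _ r hx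
  | h_gen g =>
    have m1 : (q : k) ^ 2 • (u ⊗ₜ v) - v ⊗ₜ u ∈ V1 q := Submodule.subset_span (by simp)
    have m2 : ((q : k) ^ 3 + q) • (u ⊗ₜ w - w ⊗ₜ u) + (1 - (q : k) ^ 2) • (v ⊗ₜ v) ∈ V1 q :=
      Submodule.subset_span (by simp)
    have m3 : w ⊗ₜ v - (q : k) ^ 2 • (v ⊗ₜ w) ∈ V1 q := Submodule.subset_span (by simp)
    have key (a b d : k) (y) (hy : y = a • ((q : k) ^ 2 • (u ⊗ₜ v) - v ⊗ₜ u) +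
        b • (((q : k) ^ 3 + q) • (u ⊗ₜ w - w ⊗ₜ u) + (1 - (q : k) ^ 2) • (v ⊗ₜ v)) +
        d • (w ⊗ₜ v - (q : k) ^ 2 • (v ⊗ₜ w))) : y ∈ V1 q := by
      rw [hy]
      exact add_mem (add_mem (Submodule.smul_mem _ _ m1) (Submodule.smul_mem _ _ m2))
        (Submodule.smul_mem _ _ m3)
    induction hx using Submodule.span_induction with
    | zero => rw [map_zero]; exact zero_mem _
    | add x y _ _ hx hy => rw [map_add]; exact add_mem hx hy
    | smul r x _ hx => rw [map_smul]; exact Submodule.smul_mem _ _ hx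
    | mem x hx =>
      obtain ⟨a, b, d, h⟩ : ∃ a b d : k, rhoVV q (Uq.gen q g) x =
          a • ((q : k) ^ 2 • (u ⊗ₜ v) - v ⊗ₜ u) +
          b • (((q : k) ^ 3 + q) • (u ⊗ₜ w - w ⊗ₜ u) + (1 - (q : k) ^ 2) • (v ⊗ₜ v)) +
          d • (w ⊗ₜ v - (q : k) ^ 2 • (v ⊗ₜ w)) := by
        rcases hx with rfl | rfl | rfl
        · refine ⟨match g with | .X => 0 | .Y => 0 | .K => (q : k) ^ 2 | .Kinv => ((q : k) ^ 2)⁻¹,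
            match g with | .X => 0 | .Y => 1 | .K => 0 | .Kinv => 0, 0, ?_⟩
          cases g <;>
          simp only [map_add, map_sub, map_smul, rhoVV_X, rhoVV_Y, rhoVV_K, rhoVV_Kinv, matV_u,
            matV_v, matV_w, TensorProduct.zero_tmul, TensorProduct.tmul_zero,
            TensorProduct.neg_tmul, TensorProduct.tmul_neg, ← TensorProduct.smul_tmul',
            TensorProduct.tmul_smul, zero_smul, one_smul, neg_smul] <;>
          match_scalars <;> field_simp <;> ring
        · refine ⟨match g with | .X => (q : k) + (q : k)⁻¹ | .Y => 0 | .K => 0 | .Kinv => 0,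
            match g with | .X => 0 | .Y => 0 | .K => 1 | .Kinv => 1,
            match g with | .X => 0 | .Y => (q : k) + (q : k)⁻¹ | .K => 0 | .Kinv => 0, ?_⟩
          cases g <;>
          simp only [map_add, map_sub, map_smul, rhoVV_X, rhoVV_Y, rhoVV_K, rhoVV_Kinv, matV_u,
            matV_v, matV_w, TensorProduct.zero_tmul, TensorProduct.tmul_zero,
            TensorProduct.neg_tmul, TensorProduct.tmul_neg, ← TensorProduct.smul_tmul',
            TensorProduct.tmul_smul, zero_smul, one_smul, neg_smul] <;>
          match_scalars <;> field_simp <;> ring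
        · refine ⟨0, match g with | .X => 1 | .Y => 0 | .K => 0 | .Kinv => 0,
            match g with | .X => 0 | .Y => 0 | .K => ((q : k) ^ 2)⁻¹ | .Kinv => (q : k) ^ 2, ?_⟩
          cases g <;>
          simp only [map_add, map_sub, map_smul, rhoVV_X, rhoVV_Y, rhoVV_K, rhoVV_Kinv, matV_u,
            matV_v, matV_w, TensorProduct.zero_tmul, TensorProduct.tmul_zero,
            TensorProduct.neg_tmul, TensorProduct.tmul_neg, ← TensorProduct.smul_tmul',
            TensorProduct.tmul_smul, zero_smul, one_smul, neg_smul] <;>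
          match_scalars <;> field_simp <;> ring
      exact key a b d _ h
  | h_mul a b ha hb => rw [map_mul]; exact ha _ (hb _ hx)
  | h_add a b ha hb => rw [map_add]; exact add_mem (ha _ hx) (hb _ hx)

namespace Sphere

variable (q : kˣ) (c : k)

/-- The map `x ↦ (h ↦ h.x)` on `V`, with values in the quantum sphere. -/
def actionV : V k →ₗ[k] WithConv (Uq q →ₗ[k] Sphere q c) :=
  (WithConv.linearEquiv k (Uq q →ₗ[k] Sphere q c)).symm.toLinearMap ∘ₗ
    ((rhoV q).toLinearMap.compr₂ (ι q c)).flip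

theorem mul2_actionV (x) (h : Uq q) :
    (mul2 (actionV q c) x).ofConv h = mul2 (ι q c) (rhoVV q h x) := by
  induction x with
  | zero => simp
  | add x y hx hy => simp [hx, hy]
  | tmul x y =>
    have key (t : Uq q ⊗[k] Uq q) :
        LinearMap.mul' k _ (TensorProduct.map (actionV q c x).ofConv (actionV q c y).ofConv t) =
        mul2 (ι q c) (Module.endTensorEndAlgHom (R := k) (S := k) (A := k)
          (Algebra.TensorProduct.map (rhoV q) (rhoV q) t) (x ⊗ₜ y)) := by
      induction t with
      | zero => simp
      | add s t hs ht => simp [hs, ht]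
      | tmul s t => simp [mul2, actionV, Module.endTensorEndAlgHom_apply]
    exact key _

/-- The action of `U_q(sl(2))` on the quantum sphere, written `a ↦ (h ↦ h.a)`. The extension of the
action from `V` to products through the coproduct, `h.(a b) = ∑ (h₁.a) (h₂.b)` and
`h.1 = ε(h) 1`, says exactly that this map is an algebra map to the convolution algebra of linear
maps from `U_q(sl(2))` to the quantum sphere. -/
def coaction : Sphere q c →ₐ[k] WithConv (Uq q →ₗ[k] Sphere q c) :=
  lift q c (actionV q c)
    (by
      intro x hx
      ext h
      exact (mul2_actionV q c x h).trans (mul2_V1 (rhoVV_V1 q h x hx)))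
    (by
      ext h
      refine (mul2_actionV q c _ h).trans ?_
      rw [rhoVV_v0, map_smul, mul2_v0]
      simp [Algebra.algebraMap_eq_smul_one, smul_smul, mul_comm])

/-- The element `h.a` of the quantum sphere, linearly in `h` and `a`. -/
def smulMap : Uq q →ₗ[k] Module.End k (Sphere q c) :=
  ((WithConv.linearEquiv k (Uq q →ₗ[k] Sphere q c)).toLinearMap ∘ₗ
    (coaction q c).toLinearMap).flip

variable {q c}

theorem smulMap_ι (h : Uq q) (x : V k) : smulMap q c h (ι q c x) = ι q c (rhoV q h x) := by
  simp [smulMap, coaction, actionV]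

theorem smulMap_algebraMap (h : Uq q) (r : k) : smulMap q c h (algebraMap k _ r) =
    Coalgebra.counit (R := k) h • algebraMap k _ r := by
  simp [smulMap, Algebra.algebraMap_eq_smul_one, smul_smul, mul_comm]

/-- The product of the quantum sphere is compatible with the coproduct. -/
theorem smulMap_mul (h : Uq q) (a b : Sphere q c) : smulMap q c h (a * b) = LinearMap.mul' k _
    (TensorProduct.map ((smulMap q c).flip a) ((smulMap q c).flip b)
      (Coalgebra.comul (R := k) h)) := by
  simp [smulMap]

theorem smulMap_one : smulMap q c 1 = 1 := by
  ext a
  induction a using Sphere.induction with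
  | h_scalar r => simp [smulMap_algebraMap]
  | h_gen x => simp [smulMap_ι]
  | h_add a b ha hb => simp [ha, hb]
  | h_mul a b ha hb =>
    simp [smulMap_mul, Bialgebra.comul_one, Algebra.TensorProduct.one_def, ha, hb]

theorem smulMap_mul_left (g h : Uq q) : smulMap q c (g * h) = smulMap q c g * smulMap q c h := by
  ext a
  induction a using Sphere.induction generalizing g h with
  | h_scalar r => simp [smulMap_algebraMap, smul_smul, mul_comm]
  | h_gen x => simp [smulMap_ι]
  | h_add a b ha hb => simp [ha, hb]
  | h_mul a b ha hb =>
    have h₁ (s₁ s₂ : Uq q) (r : Uq q ⊗[k] Uq q) :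
        LinearMap.mul' k _ (TensorProduct.map ((smulMap q c).flip a) ((smulMap q c).flip b)
          (r * s₁ ⊗ₜ s₂)) =
        LinearMap.mul' k _ (TensorProduct.map ((smulMap q c).flip (smulMap q c s₁ a))
          ((smulMap q c).flip (smulMap q c s₂ b)) r) := by
      induction r with
      | zero => simp
      | add x y hx hy => simp only [add_mul, map_add, hx, hy]
      | tmul x y => simp [ha, hb]
    have h₂ (t : Uq q ⊗[k] Uq q) :
        LinearMap.mul' k _ (TensorProduct.map ((smulMap q c).flip a) ((smulMap q c).flip b)
          (Coalgebra.comul (R := k) g * t)) =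
        smulMap q c g (LinearMap.mul' k _
          (TensorProduct.map ((smulMap q c).flip a) ((smulMap q c).flip b) t)) := by
      induction t with
      | zero => simp
      | add x y hx hy => simp only [mul_add, map_add, hx, hy]
      | tmul x y => simp [h₁, smulMap_mul]
    rw [smulMap_mul, Bialgebra.comul_mul, h₂, Module.End.mul_apply, smulMap_mul]

variable (q c) in
/-- The action of `U_q(sl(2))` on the quantum sphere. -/
def act : Uq q →ₐ[k] Module.End k (Sphere q c) :=
  AlgHom.ofLinearMap (smulMap q c) smulMap_one smulMap_mul_left

variable (q c) in
/-- The operator by which `X` acts on the quantum sphere. -/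
def opX : Module.End k (Sphere q c) := act q c (Uq.gen q .X)

variable (q c) in
/-- The operator by which `Y` acts on the quantum sphere. -/
def opY : Module.End k (Sphere q c) := act q c (Uq.gen q .Y)

variable (q c) in
/-- The operator by which `K⁻¹` acts on the quantum sphere. -/
def opKinv : Module.End k (Sphere q c) := act q c (Uq.gen q .Kinv)

theorem act_apply (h : Uq q) : act q c h = smulMap q c h := rfl

theorem opX_mul (a b : Sphere q c) :
    opX q c (a * b) = opX q c a * b + opKinv q c a * opX q c b := by
  simp [opX, opKinv, act_apply, smulMap_mul, Uq.comul_gen, Uq.comulGen, smulMap_one]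

theorem opX_opKinv : opX q c * opKinv q c = (q : k) ^ 2 • (opKinv q c * opX q c) := by
  rw [opX, opKinv, ← map_mul, ← map_mul, Uq.X_Kinv, map_smul]

theorem opX_pow_opKinv (n : ℕ) (a : Sphere q c) (h : (opX q c ^ n) a = 0) :
    (opX q c ^ n) (opKinv q c a) = 0 := by
  have H : ∃ r : k, opX q c ^ n * opKinv q c = r • (opKinv q c * opX q c ^ n) := by
    clear h
    induction n with
    | zero => exact ⟨1, by simp⟩
    | succ n ih =>
      obtain ⟨r, hr⟩ := ih
      refine ⟨(q : k) ^ 2 * r, ?_⟩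
      rw [pow_succ, mul_assoc, opX_opKinv, mul_smul_comm, ← mul_assoc, hr, smul_mul_assoc,
        mul_assoc, smul_smul]
  obtain ⟨r, hr⟩ := H
  rw [← Module.End.mul_apply, hr, LinearMap.smul_apply, Module.End.mul_apply, h, map_zero,
    smul_zero]

theorem opX_pow_mul (N : ℕ) : ∀ (m n : ℕ) (a b : Sphere q c), m + n = N →
    (opX q c ^ m) a = 0 → (opX q c ^ n) b = 0 → (opX q c ^ N) (a * b) = 0 := by
  induction N with
  | zero =>
    intro m n a b h ha hb
    obtain rfl : m = 0 := by omega
    simp at ha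
    simp [ha]
  | succ N ih =>
    intro m n a b h ha hb
    rw [pow_succ, Module.End.mul_apply, opX_mul, map_add]
    have h₁ : (opX q c ^ N) (opX q c a * b) = 0 := by
      rcases m with _ | m
      · simp at ha
        simp [ha]
      · exact ih m n _ _ (by omega) (by rwa [pow_succ] at ha) hb
    have h₂ : (opX q c ^ N) (opKinv q c a * opX q c b) = 0 := by
      rcases n with _ | n
      · simp at hb
        simp [hb]
      · exact ih m n _ _ (by omega) (opX_pow_opKinv m a ha) (by rwa [pow_succ] at hb)
    rw [h₁, h₂, add_zero]

theorem opX_pow_add {N n : ℕ} (h : N ≤ n) (a : Sphere q c) (ha : (opX q c ^ N) a = 0) :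
    (opX q c ^ n) a = 0 := by
  obtain ⟨m, rfl⟩ := Nat.exists_eq_add_of_le' h
  rw [pow_add, Module.End.mul_apply, ha, map_zero]

/-- `X` acts locally nilpotently on the quantum sphere. -/
theorem exists_opX_pow_eq_zero (a : Sphere q c) : ∃ N : ℕ, (opX q c ^ N) a = 0 := by
  induction a using Sphere.induction with
  | h_scalar r =>
    refine ⟨1, ?_⟩
    have : Coalgebra.counit (R := k) (Uq.gen q .X) = 0 := Uq.lift_gen _ _ _ _ _ _ _
    simp [opX, act_apply, smulMap_algebraMap, this]
  | h_gen x =>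
    refine ⟨3, ?_⟩
    have : ((rhoV q) (Uq.gen q .X)) (((rhoV q) (Uq.gen q .X)) (((rhoV q) (Uq.gen q .X)) x)) = 0 := by
      ext i
      fin_cases i <;> simp [rhoV_gen, matV, Matrix.mulVec, dotProduct, Fin.sum_univ_three]
    simp [opX, act_apply, pow_succ, smulMap_ι, this]
  | h_add a b ha hb =>
    obtain ⟨m, hm⟩ := ha
    obtain ⟨n, hn⟩ := hb
    exact ⟨m + n, by rw [map_add, opX_pow_add (by omega) a hm, opX_pow_add (by omega) b hn,
      add_zero]⟩
  | h_mul a b ha hb =>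
    obtain ⟨m, hm⟩ := ha
    obtain ⟨n, hn⟩ := hb
    exact ⟨m + n, opX_pow_mul _ m n a b rfl hm hn⟩

variable (q c) in
/-- The weight components of the elements of `V`: for `x = x₀ u + x₁ v + x₂ w`, the coefficients at
`1`, `0`, `-1` are `x₀ u`, `x₁ v`, `x₂ w`, of weights (eigenvalues of `H`) `2`, `0`, `-2`. -/
def weightsV : V k →ₗ[k] AddMonoidAlgebra (Sphere q c) ℤ where
  toFun x := .single 1 (x 0 • ι q c u) + .single 0 (x 1 • ι q c v) + .single (-1) (x 2 • ι q c w)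
  map_add' x y := by
    simp only [Pi.add_apply, add_smul, AddMonoidAlgebra.single_add]
    abel
  map_smul' r x := by
    simp only [Pi.smul_apply, smul_eq_mul, mul_smul, RingHom.id_apply, smul_add,
      AddMonoidAlgebra.smul_single]

theorem weightsV_u : weightsV q c u = .single 1 (ι q c u) := by
  simp [weightsV, u, -LaurentPolynomial.single_eq_C_mul_T,
    AddMonoidAlgebra.single_zero]

theorem weightsV_v : weightsV q c v = .single 0 (ι q c v) := by
  simp [weightsV, v, -LaurentPolynomial.single_eq_C_mul_T,
    AddMonoidAlgebra.single_zero]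

theorem weightsV_w : weightsV q c w = .single (-1) (ι q c w) := by
  simp [weightsV, w, -LaurentPolynomial.single_eq_C_mul_T,
    AddMonoidAlgebra.single_zero]

theorem mul2_weightsV (x y : V k) (i j : ℤ) (hx : weightsV q c x = .single i (ι q c x))
    (hy : weightsV q c y = .single j (ι q c y)) :
    mul2 (weightsV q c) (x ⊗ₜ y) = .single (i + j) (mul2 (ι q c) (x ⊗ₜ y)) := by
  simp only [mul2, LinearMap.comp_apply, TensorProduct.map_tmul, LinearMap.mul'_apply, hx, hy,
    AddMonoidAlgebra.single_mul_single]

theorem mul2_weightsV_V1 (x) (hx : x ∈ V1 q) : mul2 (weightsV q c) x = 0 := by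
  induction hx using Submodule.span_induction with
  | zero => simp
  | add x y _ _ hx hy => rw [map_add, hx, hy, add_zero]
  | smul r x _ hx => rw [map_smul, hx, smul_zero]
  | mem x hx =>
    have h : mul2 (ι q c) x = 0 := mul2_V1 (Submodule.subset_span hx)
    have huv := mul2_weightsV _ _ _ _ (weightsV_u (q := q) (c := c)) weightsV_v
    have hvu := mul2_weightsV _ _ _ _ (weightsV_v (q := q) (c := c)) weightsV_u
    have huw := mul2_weightsV _ _ _ _ (weightsV_u (q := q) (c := c)) weightsV_w
    have hwu := mul2_weightsV _ _ _ _ (weightsV_w (q := q) (c := c)) weightsV_u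
    have hvv := mul2_weightsV _ _ _ _ (weightsV_v (q := q) (c := c)) weightsV_v
    have hwv := mul2_weightsV _ _ _ _ (weightsV_w (q := q) (c := c)) weightsV_v
    have hvw := mul2_weightsV _ _ _ _ (weightsV_v (q := q) (c := c)) weightsV_w
    rcases hx with rfl | rfl | rfl <;>
    simp only [map_add, map_sub, map_smul, huv, hvu, huw, hwu, hvv, hwv, hvw,
      AddMonoidAlgebra.smul_single, ← AddMonoidAlgebra.single_add,
      ← AddMonoidAlgebra.single_sub, add_zero, zero_add, add_neg_cancel, neg_add_cancel] at h ⊢ <;>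
    rw [h, AddMonoidAlgebra.single_zero]

theorem mul2_weightsV_v0 : mul2 (weightsV q c) (v0 q) = algebraMap k _ c := by
  have h : mul2 (ι q c) (v0 q) = _ := mul2_v0
  have huw := mul2_weightsV _ _ _ _ (weightsV_u (q := q) (c := c)) weightsV_w
  have hwu := mul2_weightsV _ _ _ _ (weightsV_w (q := q) (c := c)) weightsV_u
  have hvv := mul2_weightsV _ _ _ _ (weightsV_v (q := q) (c := c)) weightsV_v
  simp only [v0, map_add, map_smul, huw, hwu, hvv,
    AddMonoidAlgebra.smul_single, ← AddMonoidAlgebra.single_add,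
    add_zero, add_neg_cancel, neg_add_cancel] at h ⊢
  rw [h]
  rfl

variable (q c) in
/-- The weight decomposition of the quantum sphere. `H` acts as a derivation, so weights add up
under products: the decomposition is an algebra map to Laurent polynomials over the quantum sphere,
and the coefficient of `a` at `i` is the component of `a` of weight `2 i`. -/
def weights : Sphere q c →ₐ[k] AddMonoidAlgebra (Sphere q c) ℤ :=
  lift q c (weightsV q c) mul2_weightsV_V1 mul2_weightsV_v0

variable (q c) in
/-- The projection to the subspace of weight `2 i`, the eigenspace of `H` for the eigenvalue
`2 i`. -/
def weightProj (i : ℤ) : Module.End k (Sphere q c) where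
  toFun a := (weights q c a).coeff i
  map_add' a b := by simp
  map_smul' r a := by simp

theorem finite_weightProj (a : Sphere q c) : {i | weightProj q c i a ≠ 0}.Finite :=
  (weights q c a).coeff.hasFiniteSupport

/-- `K = q ^ H` acts on the subspace of weight `2 i` by `q ^ (2 i)`. -/
theorem act_K_weightProj (i : ℤ) (a : Sphere q c) :
    act q c (Uq.gen q .K) (weightProj q c i a) = (q : k) ^ (2 * i) • weightProj q c i a := by
  have hq : (q : k) ≠ 0 := q.ne_zero
  have hK (a b : Sphere q c) : act q c (Uq.gen q .K) (a * b) =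
      act q c (Uq.gen q .K) a * act q c (Uq.gen q .K) b := by
    simp [act_apply, smulMap_mul, Uq.comul_gen, Uq.comulGen]
  have h1 (r : k) : act q c (Uq.gen q .K) (algebraMap k _ r) = algebraMap k _ r := by
    have : Coalgebra.counit (R := k) (Uq.gen q .K) = 1 := Uq.lift_gen _ _ _ _ _ _ _
    simp [act_apply, smulMap_algebraMap, this]
  change act q c (Uq.gen q .K) ((weights q c a).coeff i) = _ • (weights q c a).coeff i
  induction a using Sphere.induction generalizing i with
  | h_scalar r =>
    rw [AlgHom.commutes]
    have : algebraMap k (AddMonoidAlgebra (Sphere q c) ℤ) r = .single 0 (algebraMap k _ r) := rfl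
    rw [this, AddMonoidAlgebra.coeff_single, Finsupp.single_apply]
    split_ifs with h
    · subst h; simp [h1]
    · simp
  | h_gen x =>
    have hu : act q c (Uq.gen q .K) (ι q c u) = (q : k) ^ 2 • ι q c u := by
      rw [act_apply, smulMap_ι, rhoV_gen, matV_u, map_smul]
    have hv : act q c (Uq.gen q .K) (ι q c v) = ι q c v := by
      rw [act_apply, smulMap_ι, rhoV_gen, matV_v]
    have hw : act q c (Uq.gen q .K) (ι q c w) = ((q : k) ^ 2)⁻¹ • ι q c w := by
      rw [act_apply, smulMap_ι, rhoV_gen, matV_w, map_smul]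
    simp only [weights, lift_ι, weightsV, LinearMap.coe_mk, AddHom.coe_mk,
      AddMonoidAlgebra.coeff_add, AddMonoidAlgebra.coeff_single, Finsupp.add_apply,
      Finsupp.single_apply, map_add, smul_add]
    congr 1
    · congr 1
      · split_ifs with h
        · subst h; rw [map_smul, hu, smul_comm]; norm_cast
        · simp
      · split_ifs with h
        · subst h; simp [hv]
        · simp
    · split_ifs with h
      · subst h; rw [map_smul, hw, smul_comm]; norm_cast
      · simp
  | h_add a b ha hb => simp [ha, hb]
  | h_mul a b ha hb =>
    rw [map_mul, AddMonoidAlgebra.coeff_mul]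
    simp only [Finsupp.sum, map_sum, Finset.smul_sum]
    refine Finset.sum_congr rfl fun m _ => Finset.sum_congr rfl fun n _ => ?_
    split_ifs with h
    · subst h
      rw [hK, ha, hb, smul_mul_smul_comm, ← zpow_add₀ hq, mul_add]
    · simp

/-- Every element is the sum of its weight components. -/
theorem finsum_weightProj (a : Sphere q c) : ∑ᶠ i, weightProj q c i a = a := by
  let g : AddMonoidAlgebra (Sphere q c) ℤ →ₐ[k] Sphere q c :=
    AddMonoidAlgebra.liftNCAlgHom (AlgHom.id k _) 1 (fun _ _ => Commute.one_right _)
  have hs (i : ℤ) (b : Sphere q c) : g (.single i b) = b := by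
    simp [g, AddMonoidAlgebra.liftNCAlgHom, -LaurentPolynomial.single_eq_C_mul_T]
  have hg (x : AddMonoidAlgebra (Sphere q c) ℤ) : g x = ∑ᶠ i, x.coeff i := by
    rw [finsum_eq_sum_of_support_subset (s := x.coeff.support) _ (by simp)]
    conv_lhs => rw [← AddMonoidAlgebra.sum_coeff_single x]
    simp [Finsupp.sum, hs, -LaurentPolynomial.single_eq_C_mul_T]
  refine (hg (weights q c a)).symm.trans ?_
  induction a using Sphere.induction with
  | h_scalar r => rw [AlgHom.commutes, AlgHom.commutes]
  | h_gen x =>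
    have hx : x = x 0 • u + x 1 • v + x 2 • w := by
      ext i
      fin_cases i <;> simp [u, v, w]
    conv_rhs => rw [hx]
    simp only [weights, lift_ι, weightsV, LinearMap.coe_mk, AddHom.coe_mk, map_add, hs, map_smul]
  | h_add a b ha hb => simp [ha, hb]
  | h_mul a b ha hb => simp [ha, hb]

end Sphere

/-- The pointwise sum of a family of linear maps of which all but finitely many vanish at any given
vector. -/
def locallyFiniteSum {ι M N : Type*} [AddCommGroup M] [Module k M] [AddCommGroup N] [Module k N]
    (f : ι → M →ₗ[k] N) (hf : ∀ x, {i | f i x ≠ 0}.Finite) : M →ₗ[k] N where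
  toFun x := ∑ᶠ i, f i x
  map_add' x y := by
    simp only [map_add]
    exact finsum_add_distrib (hf x) (hf y)
  map_smul' r x := by
    simp only [map_smul, RingHom.id_apply]
    exact (smul_finsum' r (hf x)).symm

/-- The `q`-integer `[n] = (qⁿ - q⁻ⁿ) / (q - q⁻¹)`. -/
def qInt (q : kˣ) (n : ℕ) : k := ((q : k) ^ n - (q : k)⁻¹ ^ n) / ((q : k) - (q : k)⁻¹)

/-- The `q`-factorial `[n]! = [1] [2] ⋯ [n]`. -/
def qFactorial (q : kˣ) (n : ℕ) : k := ∏ i ∈ Finset.range n, qInt q (i + 1)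

/-- The coefficient `q ^ (n (n - 1) / 2) (q - q⁻¹) ^ n / [n]!` of `Xⁿ ⊗ Yⁿ` in the universal
`R`-matrix. -/
def coeffR (q : kˣ) (n : ℕ) : k :=
  (q : k) ^ (n * (n - 1) / 2) * ((q : k) - (q : k)⁻¹) ^ n / qFactorial q n

namespace Sphere

variable (q : kˣ) (c : k)

/-- The action of `q ^ (H ⊗ H / 2)` on the tensor square of the quantum sphere: the scalar
`q ^ ((2 i) (2 j) / 2)` on the tensor product of the subspaces of weights `2 i` and `2 j`. -/
def cartanPart : Module.End k (Sphere q c ⊗[k] Sphere q c) :=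
  locallyFiniteSum (ι := ℤ × ℤ)
    (fun p => (q : k) ^ (2 * p.1 * p.2) •
      TensorProduct.map (weightProj q c p.1) (weightProj q c p.2))
    (by
      intro t
      induction t with
      | zero => simp
      | add s t hs ht =>
        refine (hs.union ht).subset fun p hp => ?_
        by_contra h
        simp only [Set.mem_union, Set.mem_ofPred_eq, not_or, not_not] at h
        exact hp (by rw [map_add, h.1, h.2, add_zero])
      | tmul a b =>
        refine ((finite_weightProj a).prod (finite_weightProj b)).subset fun p hp => ?_
        refine ⟨fun h => hp ?_, fun h => hp ?_⟩ <;> simp [h])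

/-- The action of `∑ₙ q ^ (n (n - 1) / 2) (q - q⁻¹) ^ n / [n]! Xⁿ ⊗ Yⁿ` on the tensor square of the
quantum sphere. -/
def unipotentPart : Module.End k (Sphere q c ⊗[k] Sphere q c) :=
  locallyFiniteSum (ι := ℕ)
    (fun n => coeffR q n • TensorProduct.map (opX q c ^ n) (opY q c ^ n))
    (by
      intro t
      induction t with
      | zero => simp
      | add s t hs ht =>
        refine (hs.union ht).subset fun p hp => ?_
        by_contra h
        simp only [Set.mem_union, Set.mem_ofPred_eq, not_or, not_not] at h
        exact hp (by rw [map_add, h.1, h.2, add_zero])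
      | tmul a b =>
        obtain ⟨N, hN⟩ := exists_opX_pow_eq_zero a
        refine (Set.finite_lt_nat N).subset fun n hn => ?_
        by_contra h
        simp only [Set.mem_ofPred_eq, not_lt] at h
        exact hn (by simp [opX_pow_add h a hN]))

/-- The action on the tensor square of the quantum sphere of the universal `R`-matrix of
`U_q(sl(2))`,
`R = (∑ₙ q ^ (n (n - 1) / 2) (q - q⁻¹) ^ n / [n]! Xⁿ ⊗ Yⁿ) q ^ (H ⊗ H / 2)`. -/
def actR : Module.End k (Sphere q c ⊗[k] Sphere q c) := unipotentPart q c * cartanPart q c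

/-- The braiding `S = σ R`, where `σ` is the flip. -/
def braiding : Module.End k (Sphere q c ⊗[k] Sphere q c) :=
  (TensorProduct.comm k (Sphere q c) (Sphere q c)).toLinearMap ∘ₗ actR q c

end Sphere

section Legs

variable {A : Type*} [Ring A] [Algebra k A]

/-- An operator on `A ⊗ A`, applied to the first and second factors of `A ⊗ A ⊗ A`. -/
def op12 (T : Module.End k (A ⊗[k] A)) : Module.End k (A ⊗[k] A ⊗[k] A) := T.rTensor A

/-- An operator on `A ⊗ A`, applied to the second and third factors of `A ⊗ A ⊗ A`. -/
def op23 (T : Module.End k (A ⊗[k] A)) : Module.End k (A ⊗[k] A ⊗[k] A) :=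
  (TensorProduct.assoc k A A A).symm.toLinearMap ∘ₗ T.lTensor A ∘ₗ
    (TensorProduct.assoc k A A A).toLinearMap

variable (k A) in
/-- The product applied to the first and second factors of `A ⊗ A ⊗ A`. -/
def mul12 : A ⊗[k] A ⊗[k] A →ₗ[k] A ⊗[k] A := (LinearMap.mul' k A).rTensor A

variable (k A) in
/-- The product applied to the second and third factors of `A ⊗ A ⊗ A`. -/
def mul23 : A ⊗[k] A ⊗[k] A →ₗ[k] A ⊗[k] A :=
  (LinearMap.mul' k A).lTensor A ∘ₗ (TensorProduct.assoc k A A A).toLinearMap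

end Legs

end QSphere

end

/-! The unipotent part of the universal `R`-matrix is the series `Θ(X ⊗ Y)`, where `Θ` is a
`q⁻²`-exponential, so that `Θ(a + b) = Θ(a) Θ(b)` for operators with `b a = q⁻² a b`. As `A` is a
module algebra, moving `X ⊗ Y` past `μ¹²` turns it into `X ⊗ 1 ⊗ Y + K⁻¹ ⊗ X ⊗ Y`, as `Δ(X)`
dictates. These two terms commute up to `q⁻²`, so `Θ` of the sum is the product of the two `Θ`.
With `C` the action of `q ^ (H ⊗ H / 2)`, one has `(K⁻¹ ⊗ X ⊗ Y) C¹³ = C¹³ (1 ⊗ X ⊗ Y)` on weight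
vectors, which turns the product into `R μ¹² = μ¹² R¹³ R²³`. In the same way, `Δ(Y)` gives
`R μ²³ = μ²³ R¹³ R¹²`. Composing with flips yields the identities for `S`, and multiplying these by
`S⁻¹` on the appropriate legs yields those for `S⁻¹`. -/

noncomputable section

namespace QSphere

variable {k : Type*} [Field k]

section LocallyNilpotent

variable {M M' : Type*} [AddCommGroup M] [Module k M] [AddCommGroup M'] [Module k M']

/-- An operator some power of which kills any given vector, so that power series in it make
sense as operators. -/
def LocallyNilpotent (N : Module.End k M) : Prop :=
  ∀ x, ∃ n : ℕ, (N ^ n) x = 0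

theorem locallyNilpotent_of_tmul {N : Module.End k (M ⊗[k] M')}
    (h : ∀ a b, ∃ n : ℕ, (N ^ n) (a ⊗ₜ b) = 0) : LocallyNilpotent N := fun x => by
  induction x with
  | zero => exact ⟨0, map_zero _⟩
  | tmul a b => exact h a b
  | add x y hx hy =>
    obtain ⟨m, hm⟩ := hx
    obtain ⟨n, hn⟩ := hy
    exact ⟨max m n, by
      rw [map_add, Module.End.pow_map_zero_of_le (le_max_left m n) hm,
        Module.End.pow_map_zero_of_le (le_max_right m n) hn, add_zero]⟩

namespace LocallyNilpotent

variable {N : Module.End k M} {N' : Module.End k M'}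

/-- The value `∑ₙ f n Nⁿ` of a power series at a locally nilpotent operator. -/
def series (hN : LocallyNilpotent N) (f : ℕ → k) : Module.End k M :=
  locallyFiniteSum (fun n => f n • N ^ n) fun x => by
    obtain ⟨n, hn⟩ := hN x
    refine (Set.finite_lt_nat n).subset fun i hi => ?_
    by_contra hni
    exact hi (by
      rw [LinearMap.smul_apply, Module.End.pow_map_zero_of_le (not_lt.mp hni) hn, smul_zero])

theorem series_apply (hN : LocallyNilpotent N) (f : ℕ → k) {n : ℕ} {x : M}
    (hx : (N ^ n) x = 0) : hN.series f x = ∑ i ∈ Finset.range n, f i • (N ^ i) x := by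
  refine finsum_eq_sum_of_support_subset _ fun i hi => ?_
  by_contra hni
  rw [Finset.coe_range, Set.mem_Iio, not_lt] at hni
  exact hi (by simp only [LinearMap.smul_apply, Module.End.pow_map_zero_of_le hni hx, smul_zero])

theorem comp_series (hN : LocallyNilpotent N) (hN' : LocallyNilpotent N') (f : ℕ → k)
    {φ : M →ₗ[k] M'} (hφ : φ ∘ₗ N = N' ∘ₗ φ) : φ ∘ₗ hN.series f = hN'.series f ∘ₗ φ := by
  have hpow (n : ℕ) (x : M) : (N' ^ n) (φ x) = φ ((N ^ n) x) :=
    (LinearMap.congr_fun (Module.End.commute_pow_left_of_commute hφ.symm n) x)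
  ext x
  obtain ⟨n, hn⟩ := hN x
  have hn' : (N' ^ n) (φ x) = 0 := by rw [hpow, hn, map_zero]
  simp only [LinearMap.comp_apply, hN.series_apply f hn, hN'.series_apply f hn', map_sum,
    map_smul, hpow]

theorem map_left (hN : LocallyNilpotent N) (T : Module.End k M') :
    LocallyNilpotent (TensorProduct.map N T) :=
  locallyNilpotent_of_tmul fun a b => (hN a).imp fun n hn => by
    rw [TensorProduct.map_pow, TensorProduct.map_tmul, hn, TensorProduct.zero_tmul]

theorem map_right (T : Module.End k M) (hN' : LocallyNilpotent N') :
    LocallyNilpotent (TensorProduct.map T N') :=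
  locallyNilpotent_of_tmul fun a b => (hN' b).imp fun n hn => by
    rw [TensorProduct.map_pow, TensorProduct.map_tmul, hn, TensorProduct.tmul_zero]

end LocallyNilpotent

theorem bijective_of_sub_apply_mem {U : Module.End k M} {F : ℕ → Submodule k M} (hF : F 0 = ⊥)
    (hF' : ∀ x, ∃ n, x ∈ F n) (hU : ∀ n, ∀ x ∈ F (n + 1), x - U x ∈ F n) :
    Function.Bijective U := by
  constructor
  · rw [injective_iff_map_eq_zero]
    intro x hx
    obtain ⟨n, hn⟩ := hF' x
    induction n with
    | zero => rwa [hF] at hn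
    | succ n ih => exact ih (by simpa only [hx, sub_zero] using hU n x hn)
  · intro x
    obtain ⟨n, hn⟩ := hF' x
    induction n generalizing x with
    | zero =>
      rw [hF, Submodule.mem_bot] at hn
      exact ⟨0, by rw [hn, map_zero]⟩
    | succ n ih =>
      obtain ⟨y, hy⟩ := ih _ (hU n x hn)
      exact ⟨y + x, by rw [map_add, hy, sub_add_cancel]⟩

theorem LocallyNilpotent.bijective_series {N : Module.End k M} (hN : LocallyNilpotent N)
    {f : ℕ → k} (hf : f 0 = 1) : Function.Bijective (hN.series f) := by
  refine bijective_of_sub_apply_mem (F := fun n => LinearMap.ker (N ^ n)) LinearMap.ker_id hN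
    fun n x hx => ?_
  rw [LinearMap.mem_ker] at hx ⊢
  rw [hN.series_apply f hx, Finset.sum_range_succ', hf, one_smul, pow_zero,
    Module.End.one_apply, sub_add_cancel_right, map_neg, map_sum, neg_eq_zero]
  refine Finset.sum_eq_zero fun i _ => ?_
  rw [map_smul, ← Module.End.mul_apply, ← pow_add,
    Module.End.pow_map_zero_of_le (by omega) hx, smul_zero]

end LocallyNilpotent

section QExponential

open Finset.HasAntidiagonal (antidiagonal mem_antidiagonal)

/-- The coefficients `e n = (sⁿ [n]!)⁻¹`, `[n] = 1 + p + ⋯ + pⁿ⁻¹`, of a `p`-exponential series.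
The recursion is multiplied out, which forces `s`, the `[n]` and the `e n` to be nonzero. -/
structure IsQExpCoeff (p s : k) (e : ℕ → k) : Prop where
  zero : e 0 = 1
  succ (n : ℕ) : s * (∑ i ∈ Finset.range (n + 1), p ^ i) * e (n + 1) = e n

theorem pow_mul_of_mul_eq_smul {B : Type*} [Ring B] [Algebra k B] {p : k} {a b : B}
    (hba : b * a = p • (a * b)) (n : ℕ) : b ^ n * a = p ^ n • (a * b ^ n) := by
  induction n with
  | zero => simp
  | succ n ih =>
    rw [pow_succ, mul_assoc, hba, mul_smul_comm, ← mul_assoc, ih, smul_mul_assoc, smul_smul,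
      mul_assoc, ← pow_succ']

namespace IsQExpCoeff

variable {p s : k} {e : ℕ → k}

theorem ne_zero (he : IsQExpCoeff p s e) (n : ℕ) : e n ≠ 0 := by
  induction n with
  | zero => exact he.zero ▸ one_ne_zero
  | succ n ih => exact right_ne_zero_of_mul (he.succ n ▸ ih)

theorem smul_add_pow (he : IsQExpCoeff p s e) {B : Type*} [Ring B] [Algebra k B] {a b : B}
    (hba : b * a = p • (a * b)) (n : ℕ) :
    e n • (a + b) ^ n = ∑ x ∈ antidiagonal n, (e x.1 * e x.2) • (a ^ x.1 * b ^ x.2) := by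
  set g : ℕ → k := fun n => s * ∑ i ∈ Finset.range n, p ^ i with hg
  have g_zero : g 0 = 0 := by simp [hg]
  have g_add (i j : ℕ) : g (i + j) = p ^ j * g i + g j := by
    simp only [hg, add_comm i j, Finset.sum_range_add, pow_add, Finset.mul_sum]
    rw [add_comm]
    simp only [mul_left_comm]
  have g_succ (n : ℕ) : g (n + 1) * e (n + 1) = e n := he.succ n
  induction n with
  | zero => simp [he.zero]
  | succ n ih =>
    have g_ne_zero : g (n + 1) ≠ 0 := left_ne_zero_of_mul (g_succ n ▸ he.ne_zero n)
    refine smul_right_injective B g_ne_zero ?_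
    have pascal : ∀ x ∈ antidiagonal (n + 1),
        g (n + 1) • (e x.1 * e x.2) • (a ^ x.1 * b ^ x.2) =
          (p ^ x.2 * (g x.1 * e x.1) * e x.2) • (a ^ x.1 * b ^ x.2) +
            (e x.1 * (g x.2 * e x.2)) • (a ^ x.1 * b ^ x.2) := by
      intro x hx
      rw [← mem_antidiagonal.mp hx, g_add, smul_smul, ← add_smul]
      congr 1
      ring
    simp only [Finset.smul_sum]
    rw [Finset.sum_congr rfl pascal, Finset.sum_add_distrib, Finset.Nat.sum_antidiagonal_succ,
      Finset.Nat.sum_antidiagonal_succ', smul_smul, g_succ, pow_succ, ← smul_mul_assoc, ih,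
      Finset.sum_mul]
    simp only [g_zero, zero_mul, mul_zero, zero_smul, zero_add, g_succ]
    rw [← Finset.sum_add_distrib]
    refine Finset.sum_congr rfl fun x _ => ?_
    rw [mul_add, smul_mul_assoc, smul_mul_assoc, mul_assoc, pow_mul_of_mul_eq_smul hba,
      mul_smul_comm, smul_smul, ← mul_assoc, ← pow_succ, mul_assoc (a ^ x.1), ← pow_succ]
    congr 2
    ring

end IsQExpCoeff

theorem sum_range_sum_antidiagonal {M : Type*} [AddCommMonoid M] (N : ℕ) {F : ℕ → ℕ → M}
    (hF₁ : ∀ i j, N ≤ i → F i j = 0) (hF₂ : ∀ i j, N ≤ j → F i j = 0) :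
    ∑ n ∈ Finset.range (N + N), ∑ x ∈ antidiagonal n, F x.1 x.2 =
      ∑ j ∈ Finset.range N, ∑ i ∈ Finset.range N, F i j := by
  symm
  rw [Finset.sum_comm, ← Finset.sum_product' _ _ F,
    ← Finset.sum_fiberwise_of_maps_to (t := Finset.range (N + N)) (g := fun x => x.1 + x.2)
      (by simp only [Finset.mem_product, Finset.mem_range]; omega)]
  refine Finset.sum_congr rfl fun n _ => Finset.sum_subset (fun x => by simp) fun x hx hij => ?_
  simp only [Finset.mem_filter, Finset.mem_product, Finset.mem_range,
    mem_antidiagonal.mp hx, and_true, not_and_or, not_lt] at hij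
  exact hij.elim (hF₁ _ _) (hF₂ _ _)

variable {M : Type*} [AddCommGroup M] [Module k M] {p s : k} {e : ℕ → k} {a b : Module.End k M}

theorem LocallyNilpotent.exists_pow_pow_eq_zero (ha : LocallyNilpotent a)
    (hb : LocallyNilpotent b) (x : M) :
    ∃ N : ℕ, (b ^ N) x = 0 ∧ ∀ j, (a ^ N) ((b ^ j) x) = 0 := by
  obtain ⟨J, hJ⟩ := hb x
  choose I hI using fun j => ha ((b ^ j) x)
  refine ⟨max J ((Finset.range J).sup I),
    Module.End.pow_map_zero_of_le (le_max_left _ _) hJ, fun j => ?_⟩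
  by_cases hj : j < J
  · exact Module.End.pow_map_zero_of_le
      (le_max_of_le_right (Finset.le_sup (Finset.mem_range.mpr hj))) (hI j)
  · rw [Module.End.pow_map_zero_of_le (not_lt.mp hj) hJ, map_zero]

theorem IsQExpCoeff.add_pow_apply_eq_zero (he : IsQExpCoeff p s e) (hba : b * a = p • (a * b))
    {N : ℕ} {x : M} (hb : (b ^ N) x = 0) (ha : ∀ j, (a ^ N) ((b ^ j) x) = 0) :
    ((a + b) ^ (N + N)) x = 0 := by
  refine (smul_eq_zero_iff_right (he.ne_zero (N + N))).mp ?_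
  rw [← LinearMap.smul_apply, he.smul_add_pow hba, LinearMap.sum_apply]
  refine Finset.sum_eq_zero fun ij hij => ?_
  rw [LinearMap.smul_apply, Module.End.mul_apply]
  obtain hi | hj : N ≤ ij.1 ∨ N ≤ ij.2 := by
    have := mem_antidiagonal.mp hij
    omega
  · rw [Module.End.pow_map_zero_of_le hi (ha _), smul_zero]
  · rw [Module.End.pow_map_zero_of_le hj hb, map_zero, smul_zero]

theorem IsQExpCoeff.locallyNilpotent_add (he : IsQExpCoeff p s e) (hba : b * a = p • (a * b))
    (ha : LocallyNilpotent a) (hb : LocallyNilpotent b) : LocallyNilpotent (a + b) := fun x =>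
  let ⟨_, hbN, haN⟩ := ha.exists_pow_pow_eq_zero hb x
  ⟨_, he.add_pow_apply_eq_zero hba hbN haN⟩

theorem IsQExpCoeff.series_add (he : IsQExpCoeff p s e) (hba : b * a = p • (a * b))
    (ha : LocallyNilpotent a) (hb : LocallyNilpotent b) (hab : LocallyNilpotent (a + b)) :
    hab.series e = ha.series e * hb.series e := by
  ext x
  obtain ⟨N, hbN, haN⟩ := ha.exists_pow_pow_eq_zero hb x
  calc hab.series e x
    _ = ∑ n ∈ Finset.range (N + N), ∑ ij ∈ antidiagonal n,
          (e ij.1 * e ij.2) • (a ^ ij.1) ((b ^ ij.2) x) := by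
      rw [hab.series_apply e (he.add_pow_apply_eq_zero hba hbN haN)]
      refine Finset.sum_congr rfl fun n _ => ?_
      rw [← LinearMap.smul_apply, he.smul_add_pow hba, LinearMap.sum_apply]
      rfl
    _ = ∑ j ∈ Finset.range N, ∑ i ∈ Finset.range N,
          (e i * e j) • (a ^ i) ((b ^ j) x) :=
      sum_range_sum_antidiagonal N (F := fun i j => (e i * e j) • (a ^ i) ((b ^ j) x))
        (fun i j hi => by rw [Module.End.pow_map_zero_of_le hi (haN j), smul_zero])
        fun i j hj => by rw [Module.End.pow_map_zero_of_le hj hbN, map_zero, smul_zero]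
    _ = (ha.series e * hb.series e) x := by
      rw [Module.End.mul_apply, hb.series_apply e hbN, map_sum]
      refine Finset.sum_congr rfl fun j _ => ?_
      rw [map_smul, ha.series_apply e (haN j), Finset.smul_sum]
      refine Finset.sum_congr rfl fun i _ => ?_
      rw [smul_smul, mul_comm]

theorem IsQExpCoeff.series_mul_comp (he : IsQExpCoeff p s e) {M' : Type*} [AddCommGroup M']
    [Module k M'] {μ : M →ₗ[k] M'} {z c : Module.End k M'} {d c₁ c₂ : Module.End k M}
    (hz : LocallyNilpotent z) (ha : LocallyNilpotent a) (hb : LocallyNilpotent b)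
    (hd : LocallyNilpotent d) (hba : b * a = p • (a * b)) (hzμ : z ∘ₗ μ = μ ∘ₗ (a + b))
    (hcμ : c ∘ₗ μ = μ ∘ₗ (c₁ * c₂)) (hbc : b * c₁ = c₁ * d) :
    (hz.series e * c) ∘ₗ μ = μ ∘ₗ ((ha.series e * c₁) * (hd.series e * c₂)) := by
  have hab : LocallyNilpotent (a + b) := he.locallyNilpotent_add hba ha hb
  have hbc' : c₁ * hd.series e = hb.series e * c₁ := hd.comp_series hb e hbc.symm
  calc (hz.series e * c) ∘ₗ μ
    _ = (hz.series e ∘ₗ μ) ∘ₗ (c₁ * c₂) := by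
      rw [Module.End.mul_eq_comp, LinearMap.comp_assoc, hcμ, LinearMap.comp_assoc]
    _ = μ ∘ₗ (hab.series e * (c₁ * c₂)) := by
      rw [← hab.comp_series hz e hzμ.symm]
      rfl
    _ = μ ∘ₗ ((ha.series e * c₁) * (hd.series e * c₂)) := by
      rw [he.series_add hba ha hb hab, mul_assoc, ← mul_assoc (hb.series e), ← hbc', mul_assoc,
        mul_assoc]

end QExponential

section Coefficients

variable {q : kˣ}

theorem sum_range_inv_sq_pow (q : kˣ) (hq : (q : k) - (q : k)⁻¹ ≠ 0) (n : ℕ) :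
    ∑ i ∈ Finset.range (n + 1), ((q : k) ^ 2)⁻¹ ^ i = (q : k)⁻¹ ^ n * qInt q (n + 1) := by
  have hq₀ : (q : k) ≠ 0 := q.ne_zero
  have hterm : ∀ i ∈ Finset.range (n + 1),
      (q : k)⁻¹ ^ n * ((q : k)⁻¹ ^ i * (q : k) ^ (n + 1 - 1 - i)) = ((q : k) ^ 2)⁻¹ ^ i := by
    intro i hi
    have : n = (n - i) + i := by rw [Finset.mem_range] at hi; omega
    rw [Nat.add_sub_cancel, mul_left_comm]
    nth_rewrite 1 [this]
    rw [pow_add, mul_right_comm, ← mul_pow, inv_mul_cancel₀ hq₀, one_pow, one_mul, ← mul_pow]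
    ring
  rw [qInt, ← Finset.sum_congr rfl hterm, ← Finset.mul_sum, eq_comm]
  congr 1
  rw [div_eq_iff hq, ← neg_inj, ← mul_neg, neg_sub, neg_sub, geom_sum₂_mul]

theorem pow_sub_inv_pow_ne_zero (hq : ¬ IsOfFinOrder q) {n : ℕ} (hn : 0 < n) :
    (q : k) ^ n - (q : k)⁻¹ ^ n ≠ 0 := fun h => hq <| by
  rw [sub_eq_zero, inv_pow, ← mul_eq_one_iff_eq_inv₀ (pow_ne_zero n q.ne_zero), ← pow_add] at h
  exact isOfFinOrder_iff_pow_eq_one.mpr ⟨n + n, by omega, Units.ext (by push_cast; exact h)⟩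

theorem sub_inv_ne_zero (hq : ¬ IsOfFinOrder q) : (q : k) - (q : k)⁻¹ ≠ 0 := by
  simpa only [pow_one] using pow_sub_inv_pow_ne_zero hq one_pos

theorem qInt_ne_zero (hq : ¬ IsOfFinOrder q) {n : ℕ} (hn : 0 < n) : qInt q n ≠ 0 :=
  div_ne_zero (pow_sub_inv_pow_ne_zero hq hn) (sub_inv_ne_zero hq)

theorem isQExpCoeff_coeffR (hq : ¬ IsOfFinOrder q) :
    IsQExpCoeff ((q : k) ^ 2)⁻¹ ((q : k) - (q : k)⁻¹)⁻¹ (coeffR q) where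
  zero := by simp [coeffR, qFactorial]
  succ n := by
    have hq₁ := sub_inv_ne_zero hq
    have hF : qFactorial q n ≠ 0 :=
      Finset.prod_ne_zero_iff.mpr fun i _ => qInt_ne_zero hq i.succ_pos
    have hI := qInt_ne_zero hq n.succ_pos
    have triangle : (n + 1) * (n + 1 - 1) / 2 = n * (n - 1) / 2 + n := by
      rw [← Nat.choose_two_right, ← Nat.choose_two_right, Nat.choose_succ_succ' n 1,
        Nat.choose_one_right, add_comm]
    have hcancel : (q : k)⁻¹ ^ n * (q : k) ^ n = 1 := by
      rw [← mul_pow, inv_mul_cancel₀ q.ne_zero, one_pow]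
    rw [sum_range_inv_sq_pow q hq₁, coeffR, coeffR, triangle, pow_add (q : k), pow_succ (_ - _),
      qFactorial, Finset.prod_range_succ, ← qFactorial]
    generalize (q : k) - (q : k)⁻¹ = d at *
    field_simp
    linear_combination hcancel

end Coefficients

section Legs

variable {A : Type*} [Ring A] [Algebra k A]

variable (k A) in
/-- The flip `σ` of `A ⊗ A`. -/
def flip : Module.End k (A ⊗[k] A) := (TensorProduct.comm k A A).toLinearMap

theorem flip_mul_flip : flip k A * flip k A = 1 := by
  ext
  rfl

@[simp]
theorem op12_tmul (T : Module.End k (A ⊗[k] A)) (a b d : A) :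
    op12 T (a ⊗ₜ b ⊗ₜ d) = T (a ⊗ₜ b) ⊗ₜ d := rfl

@[simp]
theorem op23_tmul (T : Module.End k (A ⊗[k] A)) (a b d : A) :
    op23 T (a ⊗ₜ b ⊗ₜ d) = (TensorProduct.assoc k A A A).symm (a ⊗ₜ T (b ⊗ₜ d)) := rfl

@[simp]
theorem mul12_tmul (a b d : A) : mul12 k A (a ⊗ₜ b ⊗ₜ d) = (a * b) ⊗ₜ d := rfl

@[simp]
theorem mul23_tmul (a b d : A) : mul23 k A (a ⊗ₜ b ⊗ₜ d) = a ⊗ₜ (b * d) := rfl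

theorem op12_one : op12 (1 : Module.End k (A ⊗[k] A)) = 1 := LinearMap.rTensor_id _ _

theorem op23_one : op23 (1 : Module.End k (A ⊗[k] A)) = 1 := by
  ext
  rfl

theorem op12_mul (S T : Module.End k (A ⊗[k] A)) : op12 (S * T) = op12 S * op12 T :=
  LinearMap.rTensor_mul A S T

theorem op23_mul (S T : Module.End k (A ⊗[k] A)) : op23 (S * T) = op23 S * op23 T := by
  ext
  simp [op23]

/-- An operator on `A ⊗ A`, applied to the first and third factors of `A ⊗ A ⊗ A`. -/
def op13 (T : Module.End k (A ⊗[k] A)) : Module.End k (A ⊗[k] A ⊗[k] A) :=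
  op23 (flip k A) * op12 T * op23 (flip k A)

theorem op23_flip_tmul (t : A ⊗[k] A) (b : A) :
    op23 (flip k A) (t ⊗ₜ b) =
      op12 (flip k A) ((TensorProduct.assoc k A A A).symm (b ⊗ₜ t)) := by
  induction t with
  | zero => simp only [TensorProduct.zero_tmul, TensorProduct.tmul_zero, map_zero]
  | tmul a d => rfl
  | add t t' ht ht' => simp only [TensorProduct.add_tmul, TensorProduct.tmul_add, map_add, ht, ht']

theorem op13_eq (T : Module.End k (A ⊗[k] A)) :
    op13 T = op12 (flip k A) * op23 T * op12 (flip k A) := by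
  ext a b d
  exact op23_flip_tmul (T (a ⊗ₜ d)) b

theorem op23_flip_mul_op13 (T : Module.End k (A ⊗[k] A)) :
    op23 (flip k A) * op13 T = op12 T * op23 (flip k A) := by
  rw [op13, ← mul_assoc, ← mul_assoc, ← op23_mul, flip_mul_flip, op23_one, one_mul]

theorem op12_flip_mul_op13 (T : Module.End k (A ⊗[k] A)) :
    op12 (flip k A) * op13 T = op23 T * op12 (flip k A) := by
  rw [op13_eq, ← mul_assoc, ← mul_assoc, ← op12_mul, flip_mul_flip, op12_one, one_mul]

theorem op13_mul (S T : Module.End k (A ⊗[k] A)) : op13 (S * T) = op13 S * op13 T := by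
  rw [op13, op12_mul, ← mul_assoc, mul_assoc _ (op12 T), ← op23_flip_mul_op13, ← mul_assoc]
  rfl

theorem op12_map (f g : Module.End k A) :
    op12 (TensorProduct.map f g) = TensorProduct.map (TensorProduct.map f g) 1 := rfl

theorem op23_map (f g : Module.End k A) :
    op23 (TensorProduct.map f g) = TensorProduct.map (TensorProduct.map 1 f) g := by
  ext
  rfl

theorem op13_map (f g : Module.End k A) :
    op13 (TensorProduct.map f g) = TensorProduct.map (TensorProduct.map f 1) g := by
  ext
  rfl

section Eigenvectors

variable {T : Module.End k (A ⊗[k] A)} {r : k} {a b d : A}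

theorem op12_apply_of_eigenvector (h : T (a ⊗ₜ b) = r • (a ⊗ₜ b)) :
    op12 T (a ⊗ₜ b ⊗ₜ d) = r • (a ⊗ₜ b ⊗ₜ d) := by
  rw [op12_tmul, h, ← TensorProduct.smul_tmul']

theorem op23_apply_of_eigenvector (h : T (b ⊗ₜ d) = r • (b ⊗ₜ d)) :
    op23 T (a ⊗ₜ b ⊗ₜ d) = r • (a ⊗ₜ b ⊗ₜ d) := by
  rw [op23_tmul, h, TensorProduct.tmul_smul, map_smul, TensorProduct.assoc_symm_tmul]

theorem op13_apply_of_eigenvector (h : T (a ⊗ₜ d) = r • (a ⊗ₜ d)) :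
    op13 T (a ⊗ₜ b ⊗ₜ d) = r • (a ⊗ₜ b ⊗ₜ d) := by
  have hflip (a b d : A) : op23 (flip k A) (a ⊗ₜ b ⊗ₜ d) = a ⊗ₜ d ⊗ₜ b := rfl
  rw [op13, Module.End.mul_apply, Module.End.mul_apply, hflip, op12_apply_of_eigenvector h,
    map_smul, hflip]

end Eigenvectors

namespace LocallyNilpotent

variable {N : Module.End k (A ⊗[k] A)}

theorem op12_series (hN : LocallyNilpotent N) (hN' : LocallyNilpotent (op12 N)) (f : ℕ → k) :
    op12 (hN.series f) = hN'.series f := by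
  refine TensorProduct.ext' fun t d => ?_
  exact LinearMap.congr_fun
    (hN.comp_series hN' f (φ := (TensorProduct.mk k (A ⊗[k] A) A).flip d) rfl) t

theorem op23_series (hN : LocallyNilpotent N) (hN' : LocallyNilpotent (op23 N)) (f : ℕ → k) :
    op23 (hN.series f) = hN'.series f := by
  ext a b d
  exact LinearMap.congr_fun (hN.comp_series hN' f
    (φ := (TensorProduct.assoc k A A A).symm.toLinearMap ∘ₗ TensorProduct.mk k A (A ⊗[k] A) a)
    (by ext; rfl)) (b ⊗ₜ d)

theorem op13_series (hN : LocallyNilpotent N) (hN₁₂ : LocallyNilpotent (op12 N))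
    (hN₁₃ : LocallyNilpotent (op13 N)) (f : ℕ → k) : op13 (hN.series f) = hN₁₃.series f := by
  have h : op23 (flip k A) * hN₁₃.series f = op12 (hN.series f) * op23 (flip k A) := by
    rw [hN.op12_series hN₁₂]
    exact hN₁₃.comp_series hN₁₂ f (op23_flip_mul_op13 N)
  rw [op13, mul_assoc, ← h, ← mul_assoc, ← op23_mul, flip_mul_flip, op23_one, one_mul]

end LocallyNilpotent

/-- The product of `A` passes through the operator `T` on `A ⊗ A`, from either side, as it does for
a braiding natural with respect to the product. -/
structure BraidsMul (T : Module.End k (A ⊗[k] A)) : Prop where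
  comp_mul12 : T ∘ₗ mul12 k A = mul23 k A ∘ₗ op12 T ∘ₗ op23 T
  comp_mul23 : T ∘ₗ mul23 k A = mul12 k A ∘ₗ op23 T ∘ₗ op12 T

theorem braidsMul_flip_comp {R : Module.End k (A ⊗[k] A)}
    (h₁₂ : R ∘ₗ mul12 k A = mul12 k A ∘ₗ (op13 R * op23 R))
    (h₂₃ : R ∘ₗ mul23 k A = mul23 k A ∘ₗ (op13 R * op12 R)) :
    BraidsMul (flip k A ∘ₗ R) where
  comp_mul12 := by
    have flip_mul12 :
        flip k A ∘ₗ mul12 k A = mul23 k A ∘ₗ (op12 (flip k A) * op23 (flip k A)) := by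
      ext
      rfl
    calc (flip k A ∘ₗ R) ∘ₗ mul12 k A
      _ = (flip k A ∘ₗ mul12 k A) ∘ₗ (op13 R * op23 R) := by
        rw [LinearMap.comp_assoc, h₁₂, LinearMap.comp_assoc]
      _ = mul23 k A ∘ₗ (op12 (flip k A) * (op23 (flip k A) * op13 R) * op23 R) := by
        rw [flip_mul12]
        rfl
      _ = mul23 k A ∘ₗ (op12 (flip k A * R) * op23 (flip k A * R)) := by
        rw [op23_flip_mul_op13, op12_mul, op23_mul]
        rfl
  comp_mul23 := by
    have flip_mul23 :
        flip k A ∘ₗ mul23 k A = mul12 k A ∘ₗ (op23 (flip k A) * op12 (flip k A)) := by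
      ext
      rfl
    calc (flip k A ∘ₗ R) ∘ₗ mul23 k A
      _ = (flip k A ∘ₗ mul23 k A) ∘ₗ (op13 R * op12 R) := by
        rw [LinearMap.comp_assoc, h₂₃, LinearMap.comp_assoc]
      _ = mul12 k A ∘ₗ (op23 (flip k A) * (op12 (flip k A) * op13 R) * op12 R) := by
        rw [flip_mul23]
        rfl
      _ = mul12 k A ∘ₗ (op23 (flip k A * R) * op12 (flip k A * R)) := by
        rw [op12_flip_mul_op13, op12_mul, op23_mul]
        rfl

theorem BraidsMul.symm {S : (A ⊗[k] A) ≃ₗ[k] A ⊗[k] A} (h : BraidsMul S.toLinearMap) :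
    BraidsMul S.symm.toLinearMap := by
  have hS : S.toLinearMap * S.symm.toLinearMap = 1 := S.comp_symm
  have h₁₂ : op12 S.toLinearMap * op12 S.symm.toLinearMap = 1 := by rw [← op12_mul, hS, op12_one]
  have h₂₃ : op23 S.toLinearMap * op23 S.symm.toLinearMap = 1 := by rw [← op23_mul, hS, op23_one]
  constructor
  · rw [LinearEquiv.toLinearMap_symm_comp_eq]
    calc mul12 k A
      _ = mul12 k A ∘ₗ (op23 S.toLinearMap * (op12 S.toLinearMap * op12 S.symm.toLinearMap) *
            op23 S.symm.toLinearMap) := by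
        rw [h₁₂, mul_one, h₂₃]
        rfl
      _ = (S.toLinearMap ∘ₗ mul23 k A) ∘ₗ op12 S.symm.toLinearMap ∘ₗ op23 S.symm.toLinearMap := by
        rw [h.comp_mul23]
        rfl
  · rw [LinearEquiv.toLinearMap_symm_comp_eq]
    calc mul23 k A
      _ = mul23 k A ∘ₗ (op12 S.toLinearMap * (op23 S.toLinearMap * op23 S.symm.toLinearMap) *
            op12 S.symm.toLinearMap) := by
        rw [h₂₃, mul_one, h₁₂]
        rfl
      _ = (S.toLinearMap ∘ₗ mul12 k A) ∘ₗ op23 S.symm.toLinearMap ∘ₗ op12 S.symm.toLinearMap := by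
        rw [h.comp_mul12]
        rfl

end Legs

section Eigenspaces

variable {ι M M' : Type*} [AddCommGroup M] [Module k M] [AddCommGroup M'] [Module k M']

theorem linearMap_ext_of_iSup_eq_top {W : ι → Submodule k M} (hW : ⨆ i, W i = ⊤)
    {f g : M →ₗ[k] M'} (h : ∀ i, ∀ a ∈ W i, f a = g a) : f = g := by
  have hle : ⨆ i, W i ≤ LinearMap.eqLocus f g := iSup_le h
  exact LinearMap.ext fun a => hle (hW ▸ Submodule.mem_top)

variable {A : Type*} [AddCommGroup A] [Module k A] {W : ι → Submodule k A}

theorem tensor_ext_of_iSup_eq_top (hW : ⨆ i, W i = ⊤) {f g : A ⊗[k] A →ₗ[k] M}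
    (h : ∀ i, ∀ a ∈ W i, ∀ j, ∀ b ∈ W j, f (a ⊗ₜ b) = g (a ⊗ₜ b)) : f = g :=
  TensorProduct.ext <| linearMap_ext_of_iSup_eq_top hW fun i a ha =>
    linearMap_ext_of_iSup_eq_top hW fun j b hb => h i a ha j b hb

theorem tensor_ext₃_of_iSup_eq_top (hW : ⨆ i, W i = ⊤) {f g : A ⊗[k] A ⊗[k] A →ₗ[k] M}
    (h : ∀ i, ∀ a ∈ W i, ∀ j, ∀ b ∈ W j, ∀ l, ∀ d ∈ W l,
      f (a ⊗ₜ b ⊗ₜ d) = g (a ⊗ₜ b ⊗ₜ d)) : f = g :=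
  TensorProduct.ext <| tensor_ext_of_iSup_eq_top hW fun i a ha j b hb =>
    linearMap_ext_of_iSup_eq_top hW fun l d hd => h i a ha j b hb l d hd

theorem bijective_of_iSup_eigenspace_eq_top {T : Module.End k M}
    (h : ⨆ μ, ⨆ _ : μ ≠ 0, T.eigenspace μ = ⊤) : Function.Bijective T := by
  constructor
  · rw [← LinearMap.ker_eq_bot, ← T.eigenspace_zero]
    exact disjoint_top.mp (h ▸ T.eigenspaces_iSupIndep 0)
  · rw [← LinearMap.range_eq_top, ← top_le_iff, ← h]
    refine iSup₂_le fun μ hμ x hx => ⟨μ⁻¹ • x, ?_⟩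
    rw [map_smul, Module.End.mem_eigenspace_iff.mp hx, inv_smul_smul₀ hμ]

end Eigenspaces

section ModuleAlgebra

variable {q : kˣ} {A : Type*} [Ring A] [Algebra k A]

/-- The subspace of weight `2 i` of a representation of `U_q(sl(2))`, as an eigenspace of
`K = q ^ H`. -/
def weightSpace (ρ : Uq q →ₐ[k] Module.End k A) (i : ℤ) : Submodule k A :=
  (ρ (Uq.gen q .K)).eigenspace ((q : k) ^ (2 * i))

/-- The product of `A` commutes with the action of `U_q(sl(2))`, which acts on `A ⊗ A` through
the coproduct. -/
def MulEquivariant (ρ : Uq q →ₐ[k] Module.End k A) : Prop :=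
  ∀ h a b, ρ h (a * b) = LinearMap.mul' k A (TensorProduct.map (ρ.toLinearMap.flip a)
    (ρ.toLinearMap.flip b) (Coalgebra.comul (R := k) h))

/-- `C` is the action of `q ^ (H ⊗ H / 2)` on `A ⊗ A`: the scalar `q ^ ((2 i) (2 j) / 2)` on tensors
of vectors of weights `2 i` and `2 j`. -/
def IsCartan (ρ : Uq q →ₐ[k] Module.End k A) (C : Module.End k (A ⊗[k] A)) : Prop :=
  ∀ ⦃i a⦄, a ∈ weightSpace ρ i → ∀ ⦃j b⦄, b ∈ weightSpace ρ j →
    C (a ⊗ₜ b) = (q : k) ^ (2 * i * j) • (a ⊗ₜ b)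

/-- The action of `X ⊗ Y` on `A ⊗ A`. -/
def opXY (ρ : Uq q →ₐ[k] Module.End k A) : Module.End k (A ⊗[k] A) :=
  TensorProduct.map (ρ (Uq.gen q .X)) (ρ (Uq.gen q .Y))

/-- The action of `K⁻¹ ⊗ X ⊗ Y` on `A ⊗ A ⊗ A`. -/
def opKinvXY (ρ : Uq q →ₐ[k] Module.End k A) : Module.End k (A ⊗[k] A ⊗[k] A) :=
  TensorProduct.map (TensorProduct.map (ρ (Uq.gen q .Kinv)) (ρ (Uq.gen q .X))) (ρ (Uq.gen q .Y))

/-- The action of `X ⊗ Y ⊗ K` on `A ⊗ A ⊗ A`. -/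
def opXYK (ρ : Uq q →ₐ[k] Module.End k A) : Module.End k (A ⊗[k] A ⊗[k] A) :=
  TensorProduct.map (opXY ρ) (ρ (Uq.gen q .K))

variable {ρ : Uq q →ₐ[k] Module.End k A} {i j : ℤ} {a b : A}

theorem mem_weightSpace : a ∈ weightSpace ρ i ↔ ρ (Uq.gen q .K) a = (q : k) ^ (2 * i) • a :=
  Module.End.mem_eigenspace_iff

theorem X_apply_mem_weightSpace (ha : a ∈ weightSpace ρ i) :
    ρ (Uq.gen q .X) a ∈ weightSpace ρ (i + 1) := by
  rw [mem_weightSpace] at *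
  rw [← Module.End.mul_apply, ← map_mul, Uq.K_X, map_smul, map_mul, LinearMap.smul_apply,
    Module.End.mul_apply, ha, map_smul, smul_smul, ← zpow_natCast, ← zpow_add₀ q.ne_zero]
  congr 2
  push_cast
  ring

theorem Y_apply_mem_weightSpace (ha : a ∈ weightSpace ρ i) :
    ρ (Uq.gen q .Y) a ∈ weightSpace ρ (i - 1) := by
  rw [mem_weightSpace] at *
  rw [← Module.End.mul_apply, ← map_mul, Uq.K_Y, map_smul, map_mul, LinearMap.smul_apply,
    Module.End.mul_apply, ha, map_smul, smul_smul, ← zpow_natCast, ← zpow_neg,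
    ← zpow_add₀ q.ne_zero]
  congr 2
  push_cast
  ring

theorem Kinv_apply_of_mem_weightSpace (ha : a ∈ weightSpace ρ i) :
    ρ (Uq.gen q .Kinv) a = (q : k) ^ (-(2 * i)) • a := by
  have hcancel : ρ (Uq.gen q .Kinv) (ρ (Uq.gen q .K) a) = a := by
    rw [← Module.End.mul_apply, ← map_mul, Uq.Kinv_K, map_one, Module.End.one_apply]
  rw [mem_weightSpace.mp ha, map_smul] at hcancel
  rw [zpow_neg, eq_inv_smul_iff₀ (zpow_ne_zero _ q.ne_zero), hcancel]

namespace MulEquivariant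

theorem X_mul (hρ : MulEquivariant ρ) (a b : A) : ρ (Uq.gen q .X) (a * b) =
    ρ (Uq.gen q .X) a * b + ρ (Uq.gen q .Kinv) a * ρ (Uq.gen q .X) b := by
  simp [hρ _ a b, Uq.comul_gen, Uq.comulGen]

theorem Y_mul (hρ : MulEquivariant ρ) (a b : A) : ρ (Uq.gen q .Y) (a * b) =
    ρ (Uq.gen q .Y) a * ρ (Uq.gen q .K) b + a * ρ (Uq.gen q .Y) b := by
  simp [hρ _ a b, Uq.comul_gen, Uq.comulGen]

theorem K_mul (hρ : MulEquivariant ρ) (a b : A) :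
    ρ (Uq.gen q .K) (a * b) = ρ (Uq.gen q .K) a * ρ (Uq.gen q .K) b := by
  simp [hρ _ a b, Uq.comul_gen, Uq.comulGen]

theorem mul_mem_weightSpace (hρ : MulEquivariant ρ) (ha : a ∈ weightSpace ρ i)
    (hb : b ∈ weightSpace ρ j) : a * b ∈ weightSpace ρ (i + j) := by
  rw [mem_weightSpace] at *
  rw [hρ.K_mul, ha, hb, smul_mul_smul_comm, mul_add, zpow_add₀ q.ne_zero]

end MulEquivariant

namespace IsCartan

variable {C : Module.End k (A ⊗[k] A)}

theorem bijective (hC : IsCartan ρ C) (hW : ⨆ i, weightSpace ρ i = ⊤) : Function.Bijective C := by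
  apply bijective_of_iSup_eigenspace_eq_top
  rw [← Submodule.ker_mkQ (⨆ μ, ⨆ _ : μ ≠ 0, C.eigenspace μ), LinearMap.ker_eq_top]
  refine tensor_ext_of_iSup_eq_top hW fun i a ha j b hb => ?_
  rw [LinearMap.zero_apply, Submodule.mkQ_apply, Submodule.Quotient.mk_eq_zero]
  exact Submodule.mem_iSup_of_mem _ (Submodule.mem_iSup_of_mem
    (zpow_ne_zero (2 * i * j) q.ne_zero) (Module.End.mem_eigenspace_iff.mpr (hC ha hb)))

theorem comp_mul12 (hC : IsCartan ρ C) (hρ : MulEquivariant ρ) (hW : ⨆ i, weightSpace ρ i = ⊤) :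
    C ∘ₗ mul12 k A = mul12 k A ∘ₗ (op13 C * op23 C) := by
  refine tensor_ext₃_of_iSup_eq_top hW fun i a ha j b hb l d hd => ?_
  rw [LinearMap.comp_apply, LinearMap.comp_apply, Module.End.mul_apply, mul12_tmul,
    hC (hρ.mul_mem_weightSpace ha hb) hd, op23_apply_of_eigenvector (hC hb hd), map_smul,
    op13_apply_of_eigenvector (hC ha hd), smul_smul, map_smul, mul12_tmul,
    ← zpow_add₀ q.ne_zero]
  congr 2
  ring

theorem comp_mul23 (hC : IsCartan ρ C) (hρ : MulEquivariant ρ) (hW : ⨆ i, weightSpace ρ i = ⊤) :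
    C ∘ₗ mul23 k A = mul23 k A ∘ₗ (op13 C * op12 C) := by
  refine tensor_ext₃_of_iSup_eq_top hW fun i a ha j b hb l d hd => ?_
  rw [LinearMap.comp_apply, LinearMap.comp_apply, Module.End.mul_apply, mul23_tmul,
    hC ha (hρ.mul_mem_weightSpace hb hd), op12_apply_of_eigenvector (hC ha hb), map_smul,
    op13_apply_of_eigenvector (hC ha hd), smul_smul, map_smul, mul23_tmul,
    ← zpow_add₀ q.ne_zero]
  congr 2
  ring

theorem opKinvXY_mul_op13 (hC : IsCartan ρ C) (hW : ⨆ i, weightSpace ρ i = ⊤) :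
    opKinvXY ρ * op13 C = op13 C * op23 (opXY ρ) := by
  refine tensor_ext₃_of_iSup_eq_top hW fun i a ha j b _ l d hd => ?_
  rw [Module.End.mul_apply, Module.End.mul_apply, op13_apply_of_eigenvector (hC ha hd), map_smul,
    opKinvXY, TensorProduct.map_tmul, TensorProduct.map_tmul, Kinv_apply_of_mem_weightSpace ha,
    opXY, op23_map,
    TensorProduct.map_tmul, TensorProduct.map_tmul, Module.End.one_apply,
    op13_apply_of_eigenvector (hC ha (Y_apply_mem_weightSpace hd)), ← TensorProduct.smul_tmul',
    ← TensorProduct.smul_tmul', smul_smul, ← zpow_add₀ q.ne_zero]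
  congr 2
  ring

theorem opXYK_mul_op13 (hC : IsCartan ρ C) (hW : ⨆ i, weightSpace ρ i = ⊤) :
    opXYK ρ * op13 C = op13 C * op12 (opXY ρ) := by
  refine tensor_ext₃_of_iSup_eq_top hW fun i a ha j b _ l d hd => ?_
  rw [Module.End.mul_apply, Module.End.mul_apply, op13_apply_of_eigenvector (hC ha hd), map_smul,
    opXYK, opXY, TensorProduct.map_tmul, TensorProduct.map_tmul, mem_weightSpace.mp hd, op12_map,
    TensorProduct.map_tmul, TensorProduct.map_tmul, Module.End.one_apply,
    op13_apply_of_eigenvector (hC (X_apply_mem_weightSpace ha) hd), TensorProduct.tmul_smul,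
    smul_smul, ← zpow_add₀ q.ne_zero]
  congr 2
  ring

end IsCartan

section Hexagons

theorem MulEquivariant.opXY_comp_mul12 (hρ : MulEquivariant ρ) :
    opXY ρ ∘ₗ mul12 k A = mul12 k A ∘ₗ (op13 (opXY ρ) + opKinvXY ρ) := by
  ext a b d
  simp [opXY, opKinvXY, op13_map, hρ.X_mul, TensorProduct.add_tmul]

theorem MulEquivariant.opXY_comp_mul23 (hρ : MulEquivariant ρ) :
    opXY ρ ∘ₗ mul23 k A = mul23 k A ∘ₗ (op13 (opXY ρ) + opXYK ρ) := by
  ext a b d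
  simp [opXY, opXYK, op13_map, hρ.Y_mul, TensorProduct.tmul_add, add_comm]

theorem opKinvXY_mul_op13_opXY :
    opKinvXY ρ * op13 (opXY ρ) = ((q : k) ^ 2)⁻¹ • (op13 (opXY ρ) * opKinvXY ρ) := by
  rw [opXY, op13_map, opKinvXY, ← TensorProduct.map_mul, ← TensorProduct.map_mul,
    ← TensorProduct.map_mul, ← TensorProduct.map_mul, one_mul, mul_one, ← map_mul ρ (Uq.gen q .X),
    Uq.X_Kinv, map_smul, map_mul, TensorProduct.map_smul_left, TensorProduct.map_smul_left,
    inv_smul_smul₀ (pow_ne_zero 2 q.ne_zero)]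

theorem opXYK_mul_op13_opXY :
    opXYK ρ * op13 (opXY ρ) = ((q : k) ^ 2)⁻¹ • (op13 (opXY ρ) * opXYK ρ) := by
  rw [opXYK, opXY, op13_map, ← TensorProduct.map_mul, ← TensorProduct.map_mul,
    ← TensorProduct.map_mul, ← TensorProduct.map_mul, one_mul, mul_one,
    ← map_mul ρ (Uq.gen q .K), Uq.K_Y, map_smul, map_mul, TensorProduct.map_smul_right]

namespace LocallyNilpotent

variable (hX : LocallyNilpotent (ρ (Uq.gen q .X)))

include hX

theorem opXY : LocallyNilpotent (opXY ρ) := hX.map_left _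

theorem op12_opXY : LocallyNilpotent (op12 (QSphere.opXY ρ)) := hX.opXY.map_left _

theorem op23_opXY : LocallyNilpotent (op23 (QSphere.opXY ρ)) := by
  rw [QSphere.opXY, op23_map]
  exact (hX.map_right _).map_left _

theorem op13_opXY : LocallyNilpotent (op13 (QSphere.opXY ρ)) := by
  rw [QSphere.opXY, op13_map]
  exact (hX.map_left _).map_left _

theorem opKinvXY : LocallyNilpotent (opKinvXY ρ) := (hX.map_right _).map_left _

theorem opXYK : LocallyNilpotent (opXYK ρ) := hX.opXY.map_left _

end LocallyNilpotent

theorem IsQExpCoeff.braidsMul {s : k} {e : ℕ → k} (he : IsQExpCoeff ((q : k) ^ 2)⁻¹ s e)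
    (hρ : MulEquivariant ρ) (hW : ⨆ i, weightSpace ρ i = ⊤)
    (hX : LocallyNilpotent (ρ (Uq.gen q .X))) {C : Module.End k (A ⊗[k] A)} (hC : IsCartan ρ C) :
    BraidsMul (flip k A ∘ₗ (hX.opXY.series e * C)) := by
  refine braidsMul_flip_comp ?_ ?_
  · rw [op13_mul, op23_mul, hX.opXY.op13_series hX.op12_opXY hX.op13_opXY,
      hX.opXY.op23_series hX.op23_opXY]
    exact he.series_mul_comp hX.opXY hX.op13_opXY hX.opKinvXY hX.op23_opXY
      opKinvXY_mul_op13_opXY hρ.opXY_comp_mul12 (hC.comp_mul12 hρ hW) (hC.opKinvXY_mul_op13 hW)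
  · rw [op13_mul, op12_mul, hX.opXY.op13_series hX.op12_opXY hX.op13_opXY,
      hX.opXY.op12_series hX.op12_opXY]
    exact he.series_mul_comp hX.opXY hX.op13_opXY hX.opXYK hX.op12_opXY
      opXYK_mul_op13_opXY hρ.opXY_comp_mul23 (hC.comp_mul23 hρ hW) (hC.opXYK_mul_op13 hW)

end Hexagons

end ModuleAlgebra

section Sphere

variable {q : kˣ} {c : k}

theorem weightSpace_iSupIndep (hq : ¬ IsOfFinOrder q) {A : Type*} [Ring A] [Algebra k A]
    (ρ : Uq q →ₐ[k] Module.End k A) : iSupIndep (weightSpace ρ) := by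
  refine (Module.End.eigenspaces_iSupIndep (ρ (Uq.gen q .K))).comp fun i j hij => ?_
  have hij' : q ^ (2 * i) = q ^ (2 * j) := Units.ext (by push_cast; exact hij)
  have := injective_zpow_iff_not_isOfFinOrder.mpr hq hij'
  omega

namespace Sphere

theorem mulEquivariant_act : MulEquivariant (act q c) := smulMap_mul

theorem locallyNilpotent_act_X : LocallyNilpotent (act q c (Uq.gen q .X)) := exists_opX_pow_eq_zero

theorem weightProj_mem_weightSpace (i : ℤ) (a : Sphere q c) :
    weightProj q c i a ∈ weightSpace (act q c) i :=
  mem_weightSpace.mpr (act_K_weightProj i a)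

theorem iSup_weightSpace_act : ⨆ i, weightSpace (act q c) i = ⊤ := by
  refine eq_top_iff.mpr fun a _ => ?_
  rw [← finsum_weightProj a]
  exact finsum_induction (· ∈ ⨆ i, weightSpace (act q c) i) (zero_mem _) (fun _ _ => add_mem)
    fun i => Submodule.mem_iSup_of_mem i (weightProj_mem_weightSpace i a)

theorem weightProj_apply_of_mem (hq : ¬ IsOfFinOrder q) {i : ℤ} {a : Sphere q c}
    (ha : a ∈ weightSpace (act q c) i) (j : ℤ) : weightProj q c j a = if j = i then a else 0 := by
  let t := insert i (insert j (finite_weightProj a).toFinset)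
  have hij : i ∈ t ∧ j ∈ t := by simp [t]
  have hsupp : (fun l => weightProj q c l a).support ⊆ t := fun l hl => by
    simpa [t] using Or.inr (Or.inr hl)
  have hsum : ∑ l ∈ t, weightProj q c l a = ∑ l ∈ t, if l = i then a else 0 := by
    rw [Finset.sum_ite_eq' t i, if_pos hij.1, ← finsum_eq_sum_of_support_subset _ hsupp,
      finsum_weightProj]
  have hmem (l : ℤ) : (if l = i then a else 0) ∈ weightSpace (act q c) l := by
    split_ifs with h
    exacts [h ▸ ha, zero_mem _]
  exact (iSupIndep_iff_finsetSum_eq_imp_eq _).mp (weightSpace_iSupIndep hq (act q c)) t _ _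
    (fun l _ => ⟨weightProj_mem_weightSpace l a, hmem l⟩) hsum j hij.2

theorem isCartan_cartanPart (hq : ¬ IsOfFinOrder q) : IsCartan (act q c) (cartanPart q c) := by
  intro i a ha j b hb
  refine (finsum_eq_single _ (i, j) fun p hp => ?_).trans ?_
  · rw [LinearMap.smul_apply, TensorProduct.map_tmul, weightProj_apply_of_mem hq ha,
      weightProj_apply_of_mem hq hb]
    rcases not_and_or.mp (mt Prod.ext_iff.mpr hp) with h | h
    · rw [if_neg h, TensorProduct.zero_tmul, smul_zero]
    · rw [if_neg h, TensorProduct.tmul_zero, smul_zero]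
  · rw [LinearMap.smul_apply, TensorProduct.map_tmul, weightProj_apply_of_mem hq ha,
      weightProj_apply_of_mem hq hb, if_pos rfl, if_pos rfl]

theorem unipotentPart_eq_series :
    unipotentPart q c = (locallyNilpotent_act_X (c := c)).opXY.series (coeffR q) := by
  refine LinearMap.ext fun t => finsum_congr fun n => ?_
  simp only [opXY, TensorProduct.map_pow]
  rfl

theorem braidsMul_braiding (hq : ¬ IsOfFinOrder q) : BraidsMul (braiding q c) := by
  rw [braiding, actR, unipotentPart_eq_series]
  exact (isQExpCoeff_coeffR hq).braidsMul mulEquivariant_act iSup_weightSpace_act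
    locallyNilpotent_act_X (isCartan_cartanPart hq)

theorem bijective_actR (hq : ¬ IsOfFinOrder q) : Function.Bijective (actR q c) := by
  rw [actR, unipotentPart_eq_series]
  exact (locallyNilpotent_act_X.opXY.bijective_series (isQExpCoeff_coeffR hq).zero).comp
    ((isCartan_cartanPart hq).bijective iSup_weightSpace_act)

theorem bijective_braiding (hq : ¬ IsOfFinOrder q) : Function.Bijective (braiding q c) :=
  (TensorProduct.comm k _ _).bijective.comp (bijective_actR hq)

end Sphere

end Sphere

end QSphere

end

theorem proposition1_general {k : Type*} [Field k] (q : kˣ) (hq : ∀ n : ℕ, 0 < n → q ^ n ≠ 1)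
    (c : k) :
    ∃ S : QSphere.Sphere q c ⊗[k] QSphere.Sphere q c ≃ₗ[k]
        QSphere.Sphere q c ⊗[k] QSphere.Sphere q c,
      S.toLinearMap = QSphere.Sphere.braiding q c ∧
      ∀ T ∈ ({S.toLinearMap, S.symm.toLinearMap} :
          Set (Module.End k (QSphere.Sphere q c ⊗[k] QSphere.Sphere q c))),
        T ∘ₗ QSphere.mul12 k (QSphere.Sphere q c) =
          QSphere.mul23 k (QSphere.Sphere q c) ∘ₗ QSphere.op12 T ∘ₗ QSphere.op23 T ∧
        T ∘ₗ QSphere.mul23 k (QSphere.Sphere q c) =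
          QSphere.mul12 k (QSphere.Sphere q c) ∘ₗ QSphere.op23 T ∘ₗ QSphere.op12 T := by
  have hq' : ¬ IsOfFinOrder q := by
    simpa only [isOfFinOrder_iff_pow_eq_one, not_exists, not_and] using hq
  let S := LinearEquiv.ofBijective _ (QSphere.Sphere.bijective_braiding (c := c) hq')
  have hS : QSphere.BraidsMul S.toLinearMap := QSphere.Sphere.braidsMul_braiding hq'
  refine ⟨S, rfl, ?_⟩
  rintro T (rfl | rfl)
  · exact ⟨hS.comp_mul12, hS.comp_mul23⟩
  · exact ⟨hS.symm.comp_mul12, hS.symm.comp_mul23⟩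

/-- The braiding `S = σ R` of the quantum sphere, for `q` not a root of unity, is invertible, and both
`T = S` and `T = S⁻¹` satisfy `T μ¹² = μ²³ T¹² T²³` and `T μ²³ = μ¹² T²³ T¹²`. -/
theorem proposition1 {k : Type*} [RCLike k] (q : kˣ) (hq : ∀ n : ℕ, 0 < n → q ^ n ≠ 1)
    (c : k) (hc : c ≠ 0) :
    ∃ S : QSphere.Sphere q c ⊗[k] QSphere.Sphere q c ≃ₗ[k]
        QSphere.Sphere q c ⊗[k] QSphere.Sphere q c,
      S.toLinearMap = QSphere.Sphere.braiding q c ∧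
      ∀ T ∈ ({S.toLinearMap, S.symm.toLinearMap} :
          Set (Module.End k (QSphere.Sphere q c ⊗[k] QSphere.Sphere q c))),
        T ∘ₗ QSphere.mul12 k (QSphere.Sphere q c) =
          QSphere.mul23 k (QSphere.Sphere q c) ∘ₗ QSphere.op12 T ∘ₗ QSphere.op23 T ∧
        T ∘ₗ QSphere.mul23 k (QSphere.Sphere q c) =
          QSphere.mul12 k (QSphere.Sphere q c) ∘ₗ QSphere.op23 T ∘ₗ QSphere.op12 T :=
  proposition1_general q hq c
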